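/- **Setting.** Let $p$ be a prime and $P$ a finite $p$-group. A *divisible $P$-category* $\mathcal F$ is a subcategory of the category of finite groups whose objects are the subgroups of $P$, whose morphisms are injective homomorphisms, which contains all homomorphisms $Q\to R$ ($Q,R\le P$) induced by conjugation by elements of $P$, and such that, whenever $\varphi\in\mathcal F(Q,R)$ and $\psi\in\mathcal F(Q,T)$ (morphisms $R\to Q$ and $T\to Q$) and $\theta\colon R\to T$ is a group homomorphism with $\psi\circ\theta=\varphi$, then $\theta\in\mathcal F(T,R)$. Write $\mathcal F(P,Q)$ for the set of $\mathcal F$-morphisms $Q\to P$, $\mathcal F(Q)$ for the group of $\mathcal F$-automorphisms of $Q$, $\mathcal F_P(Q)$ for the group of automorphisms of $Q$ induced by $N_P(Q)$, and $\iota_Q\colon Q\to P$ for the inclusion. $\mathcal F$ is a *Frobenius $P$-category* if $\mathcal F_P(P)$ is a Sylow $p$-subgroup of $\mathcal F(P)$ and every $\varphi\in\mathcal F(P,Q)$ such that $\zeta\big(C_P(\varphi(Q))\big)=C_P\big(\zeta(\varphi(Q))\big)$ for every $\mathcal F$-morphism $\zeta\colon\varphi(Q)\,C_P(\varphi(Q))\to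 P$ extends to an $\mathcal F$-morphism $N\to P$, where $N$ is the group of all $u\in N_P(Q)$ for which there is $v\in N_P(\varphi(Q))$ with $\varphi(uxu^{-1})=v\varphi(x)v^{-1}$ for all $x\in Q$. For finite groups $G,H$ let $\mathcal B_{G,H}$ be the free $\mathbb Z$-module on the isomorphism classes of transitive $G\times H$-sets; a finite $G\times H$-set determines the sum of the classes of its orbits. For $G\times H$-sets $X$ and $H\times K$-sets $Y$, let $X\times_H Y$ be the $G\times K$-set of the orbits of $H$ on $X\times Y$, where $h$ sends $(x,y)$ to $\big((1,h)x,(h,1)y\big)$; it induces biadditive products $\mathcal B_{G,H}\times\mathcal B_{H,K}\to\mathcal B_{G,K}$, and $\mathcal B_{P,P}$ (written $\mathcal B_{P\times P}$, the double Burnside algebra of $P$) becomes a ring. Let $f\mapsto f^\circ$ be the additive involution of $\mathcal B_{P\times P}$ exchanging the two factors $P$. For a homomorphism $\varphi\colon Q\to P$ with $Q\le P$, put $\Delta_\varphi(Q)=\{(\varphi(u),u)\mid u\in Q\}$, let $f_{Q,\varphi}\in\mathcal B_{P\times P}$ be the class of $(P\times P)/\Delta_\varphi(Q)$, and let $\mathrm{res}_\varphi\in\mathcal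 B_{Q,P}$ be the class of the $Q\times P$-set $P$ on which $(u,v)$ sends $w$ to $\varphi(u)wv^{-1}$. The *Hecke algebra* $\mathcal H_{\mathcal F}$ of $\mathcal F$ is the subring of $\mathcal B_{P\times P}$ spanned over $\mathbb Z$ by all $f_{Q,\varphi}$ with $Q\le P$ and $\varphi\in\mathcal F(P,Q)$. With $\mathcal H=\mathcal H_{\mathcal F}$, let $\mathcal H^{\mathcal F}$ be the set of $f\in\mathcal H$ such that $\mathrm{res}_\varphi\cdot f=\mathrm{res}_{\iota_Q}\cdot f$ and $\mathrm{res}_\varphi\cdot f^\circ=\mathrm{res}_{\iota_Q}\cdot f^\circ$ for all $Q\le P$ and $\varphi\in\mathcal F(P,Q)$. The *length* is the additive map $\ell$ on $\mathcal H$ with $\ell(f_{Q,\varphi})=|(P\times P)/\Delta_\varphi(Q)|/|P|=|P:Q|$. For $f\in\mathcal H$, let $\mathcal H_f$ be the minimal Hecke algebra containing $f$, that is, the intersection of all $\mathcal H_{\mathcal F'}\ni f$ with $\mathcal F'$ a divisible $P$-category, and let $\mathcal F^f$ be the divisible $P$-category for which $\mathcal F^f(P,Q)$ consists of the injective homomorphisms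 $\varphi\colon Q\to P$ with $\mathrm{res}_\varphi\cdot f=\mathrm{res}_{\iota_Q}\cdot f$ and $\mathrm{res}_\varphi\cdot f^\circ=\mathrm{res}_{\iota_Q}\cdot f^\circ$, a homomorphism $Q\to R$ being a morphism of $\mathcal F^f$ when its composite with $\iota_R$ lies in $\mathcal F^f(P,Q)$. **Proposition 7.6.** Let $\mathcal F$ be a divisible $P$-category and put $\mathcal H=\mathcal H_{\mathcal F}$. If $f\in\mathcal H^{\mathcal F}$ and $\ell(f)$ is prime to $p$, then $\mathcal F$ is a Frobenius $P$-category, $\mathcal F^f=\mathcal F$ and $\mathcal H_f=\mathcal H$. -/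

import Mathlib

namespace Puig

open MulAction

/-! ### Conjugacy classes of subgroups and the class of a finite `H × G`-set -/

section Classes

variable (A : Type*) [Group A]

/-- Two subgroups are equivalent when they are conjugate. -/
def conjSetoid : Setoid (Subgroup A) where
  r D E := ∃ a : A, E = D.map (MulAut.conj a).toMonoidHom
  iseqv :=
    { refl := fun D => ⟨1, by ext x; simp⟩
      symm := by
        rintro D E ⟨a, rfl⟩
        refine ⟨a⁻¹, ?_⟩
        ext x
        simp [mul_assoc]
      trans := by
        rintro D E K ⟨a, rfl⟩ ⟨b, rfl⟩
        refine ⟨b * a, ?_⟩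
        rw [Subgroup.map_map]
        congr 1
        ext x
        simp [mul_assoc] }

/-- Conjugacy classes of subgroups of `A`; they label the isomorphism classes of transitive
`A`-sets, the class of `D` corresponding to `A / D`. -/
def SubgroupConjClass : Type _ := Quotient (conjSetoid A)

variable {A}

/-- The conjugacy class of a subgroup. -/
def SubgroupConjClass.mk (D : Subgroup A) : SubgroupConjClass A := Quotient.mk (conjSetoid A) D

/-- A subgroup representing a conjugacy class. -/
noncomputable def SubgroupConjClass.out (c : SubgroupConjClass A) : Subgroup A := Quotient.out c

theorem SubgroupConjClass.mk_out (c : SubgroupConjClass A) : SubgroupConjClass.mk c.out = c :=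
  Quotient.out_eq c

theorem SubgroupConjClass.mk_eq_mk {D E : Subgroup A} :
    SubgroupConjClass.mk D = SubgroupConjClass.mk E ↔ ∃ a : A, E = D.map (MulAut.conj a).toMonoidHom :=
  Quotient.eq (r := conjSetoid A)

/-- The isomorphism class of an orbit, given by the conjugacy class of the point stabilizers. -/
def stabClass {X : Type*} [MulAction A X] : orbitRel.Quotient A X → SubgroupConjClass A :=
  Quotient.lift (fun x => SubgroupConjClass.mk (stabilizer A x)) (by
    rintro x y ⟨a, rfl⟩
    exact (SubgroupConjClass.mk_eq_mk.2 ⟨a, stabilizer_smul_eq_stabilizer_map_conj a y⟩).symm)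

end Classes

/-- The double Burnside module: the free `ℤ`-module over the set of isomorphism classes of
transitive `H × G`-sets `(H × G) / D` (equivalently, of the indecomposable functors from finite
`G`-sets to finite `H`-sets that they determine). -/
def Burnside (H G : Type*) [Group H] [Group G] : Type _ := SubgroupConjClass (H × G) →₀ ℤ

section Burnside

variable {H G : Type*} [Group H] [Group G]

noncomputable instance : AddCommGroup (Burnside H G) :=
  inferInstanceAs (AddCommGroup (SubgroupConjClass (H × G) →₀ ℤ))

/-- The basis element given by a conjugacy class of subgroups. -/
noncomputable def Burnside.basis (c : SubgroupConjClass (H × G)) : Burnside H G := Finsupp.single c 1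

/-- The isomorphism class of the transitive `H × G`-set `(H × G) / D`. -/
noncomputable def Burnside.ofSubgroup (D : Subgroup (H × G)) : Burnside H G :=
  Burnside.basis (SubgroupConjClass.mk D)

variable (H G) in
/-- The element determined by a finite `H × G`-set: the sum of the classes of its orbits. -/
noncomputable def bisetClass (X : Type*) [MulAction (H × G) X] : Burnside H G :=
  ∑ᶠ o : orbitRel.Quotient (H × G) X, Burnside.basis (stabClass o)

/-- The additive extension of a map defined on the canonical basis. -/
noncomputable def Burnside.extend {M : Type*} [AddCommGroup M]
    (φ : SubgroupConjClass (H × G) → M) : Burnside H G →+ M :=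
  Finsupp.liftAddHom fun c => zmultiplesHom M (φ c)

theorem Burnside.extend_basis {M : Type*} [AddCommGroup M]
    (φ : SubgroupConjClass (H × G) → M) (c : SubgroupConjClass (H × G)) :
    Burnside.extend φ (Burnside.basis c) = φ c := by
  unfold Burnside.extend Burnside.basis
  erw [Finsupp.liftAddHom_apply_single]
  simp

theorem Burnside.induction {p : Burnside H G → Prop} (x : Burnside H G)
    (hb : ∀ c, p (Burnside.basis c)) (h0 : p 0) (hadd : ∀ x y, p x → p y → p (x + y))
    (hneg : ∀ x, p x → p (-x)) : p x := by
  have hz : ∀ (n : ℤ) (x : Burnside H G), p x → p (n • x) := by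
    intro n x hx
    induction n with
    | zero => simpa using h0
    | succ n ih => rw [add_zsmul, one_zsmul]; exact hadd _ _ ih hx
    | pred n ih => rw [sub_eq_add_neg, add_zsmul, neg_one_zsmul]; exact hadd _ _ ih (hneg _ hx)
  refine Finsupp.induction_linear (motive := p) x h0 hadd ?_
  intro c n
  have := hz n _ (hb c)
  have e : n • Burnside.basis c = (Finsupp.single c n : SubgroupConjClass (H × G) →₀ ℤ) := by
    unfold Burnside.basis
    erw [Finsupp.smul_single]
    exact congrArg (Finsupp.single c) (mul_one n)
  rwa [e] at this

theorem Burnside.hom_ext {M : Type*} [AddCommGroup M] {φ ψ : Burnside H G →+ M}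
    (h : ∀ c, φ (Burnside.basis c) = ψ (Burnside.basis c)) : φ = ψ := by
  ext x
  refine Burnside.induction (p := fun x => φ x = ψ x) x h (by simp) ?_ ?_
  · intro x y hx hy; simp [hx, hy]
  · intro x hx; simp [hx]

/-- A finite decomposition of a biset into bisets gives a sum of classes. -/
theorem bisetClass_decomp {I : Type*} [Finite I] {Z : Type*} [MulAction (H × G) Z] [Finite Z]
    {W : I → Type*} [∀ i, MulAction (H × G) (W i)] (f : ∀ i, W i → Z)
    (hf : ∀ i (a : H × G) w, f i (a • w) = a • f i w)
    (hb : Function.Bijective (fun s : Σ i, W i => f s.1 s.2)) :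
    bisetClass H G Z = ∑ᶠ i, bisetClass H G (W i) := by
  classical
  have hfin : ∀ i, Finite (W i) := fun i =>
    Finite.of_injective (f i) (fun a b h => by
      have := hb.1 (a₁ := ⟨i, a⟩) (a₂ := ⟨i, b⟩) h
      simpa using this)
  let e : (Σ i, orbitRel.Quotient (H × G) (W i)) → orbitRel.Quotient (H × G) Z := fun s =>
    Quotient.map' (f s.1) (by
      rintro x y ⟨a, rfl⟩
      exact ⟨a, (hf s.1 a y).symm⟩) s.2
  have he : Function.Bijective e := by
    constructor
    · rintro ⟨i, o⟩ ⟨j, o'⟩ h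
      induction o using Quotient.inductionOn' with | _ x
      induction o' using Quotient.inductionOn' with | _ y
      have h' : f i x ∈ orbit (H × G) (f j y) := Quotient.exact h
      obtain ⟨a, ha⟩ := h'
      have h2 : (⟨j, a • y⟩ : Σ i, W i) = ⟨i, x⟩ := hb.1 (by
        change f j (a • y) = f i x
        rw [hf]; exact ha)
      obtain ⟨rfl, h3⟩ := Sigma.mk.inj_iff.1 h2
      have h3 := eq_of_heq h3
      congr 1
      exact Quotient.sound ⟨a, h3⟩
    · intro o
      induction o using Quotient.inductionOn' with | _ z
      obtain ⟨⟨i, x⟩, hx⟩ := hb.2 z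
      exact ⟨⟨i, Quotient.mk _ x⟩, congrArg (Quotient.mk _) hx⟩
  have hs : ∀ s, stabClass (e s) = stabClass s.2 := by
    rintro ⟨i, o⟩
    induction o using Quotient.inductionOn' with | _ x
    change SubgroupConjClass.mk (stabilizer (H × G) (f i x)) = SubgroupConjClass.mk (stabilizer (H × G) x)
    congr 1
    ext a
    rw [mem_stabilizer_iff, mem_stabilizer_iff, ← hf]
    constructor
    · intro h
      have := hb.1 (a₁ := ⟨i, a • x⟩) (a₂ := ⟨i, x⟩) h
      simpa using this
    · intro h; rw [h]
  have : ∀ i, Finite (orbitRel.Quotient (H × G) (W i)) := fun i => Quotient.finite _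
  have : Finite (orbitRel.Quotient (H × G) Z) := Quotient.finite _
  have := Fintype.ofFinite I
  have := fun i => Fintype.ofFinite (orbitRel.Quotient (H × G) (W i))
  have := Fintype.ofFinite (orbitRel.Quotient (H × G) Z)
  unfold bisetClass
  simp only [finsum_eq_sum_of_fintype]
  rw [← Fintype.sum_sigma (fun s : (Σ i, orbitRel.Quotient (H × G) (W i)) =>
    (Burnside.basis (stabClass s.2) : Burnside H G))]
  exact (Fintype.sum_bijective e he _ _ (fun s => by rw [hs])).symm

/-- Isomorphic bisets have the same class. -/
theorem bisetClass_congr {Z W : Type*} [MulAction (H × G) Z] [MulAction (H × G) W] [Finite Z]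
    (f : W → Z) (hf : ∀ (a : H × G) w, f (a • w) = a • f w) (hb : Function.Bijective f) :
    bisetClass H G Z = bisetClass H G W := by
  rw [bisetClass_decomp (I := Unit) (W := fun _ => W) (fun _ => f) (fun _ => hf)]
  · simp [finsum_eq_sum_of_fintype]
  · refine ⟨?_, ?_⟩
    · rintro ⟨_, a⟩ ⟨_, b⟩ h
      have : a = b := hb.1 h
      rw [this]
    · intro z
      obtain ⟨w, hw⟩ := hb.2 z
      exact ⟨⟨(), w⟩, hw⟩

theorem bisetClass_quotient (D : Subgroup (H × G)) :
    bisetClass H G ((H × G) ⧸ D) = Burnside.ofSubgroup D := by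
  let o : orbitRel.Quotient (H × G) ((H × G) ⧸ D) :=
    Quotient.mk _ ((1 : H × G) : (H × G) ⧸ D)
  have ho : ∀ o', o' = o := by
    intro o'
    induction o' using Quotient.inductionOn' with | _ x
    exact Quotient.sound (exists_smul_eq (H × G) _ x)
  have : Unique (orbitRel.Quotient (H × G) ((H × G) ⧸ D)) := ⟨⟨o⟩, ho⟩
  unfold bisetClass
  rw [finsum_unique, ho (@default _ this.toInhabited)]
  change Burnside.basis (SubgroupConjClass.mk _) = _
  rw [stabilizer_quotient]
  rfl

/-- Every basis element is the class of a coset space. -/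
theorem basis_eq (c : SubgroupConjClass (H × G)) :
    Burnside.basis c = bisetClass H G ((H × G) ⧸ c.out) := by
  rw [bisetClass_quotient, Burnside.ofSubgroup, SubgroupConjClass.mk_out]

/-- In every orbit there is a point whose stabilizer is the chosen representative. -/
theorem exists_point {X : Type*} [MulAction (H × G) X] (o : orbitRel.Quotient (H × G) X) :
    ∃ x : X, Quotient.mk _ x = o ∧ stabilizer (H × G) x = (stabClass o).out := by
  induction o using Quotient.inductionOn' with | _ x
  have h : SubgroupConjClass.mk (stabilizer (H × G) x) =
      SubgroupConjClass.mk (stabClass (Quotient.mk (orbitRel (H × G) X) x)).out := by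
    rw [SubgroupConjClass.mk_out]; rfl
  obtain ⟨a, ha⟩ := SubgroupConjClass.mk_eq_mk.1 h
  refine ⟨a • x, Quotient.sound ⟨a, rfl⟩, ?_⟩
  rw [stabilizer_smul_eq_stabilizer_map_conj]
  exact ha.symm

/-- A biset is the disjoint union of the coset spaces attached to its orbits. -/
theorem exists_decomp (X : Type*) [MulAction (H × G) X] :
    ∃ u : ∀ o : orbitRel.Quotient (H × G) X, (H × G) ⧸ (stabClass o).out → X,
      (∀ o (a : H × G) w, u o (a • w) = a • u o w) ∧
      Function.Bijective
        (fun s : Σ o : orbitRel.Quotient (H × G) X, (H × G) ⧸ (stabClass o).out => u s.1 s.2) := by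
  choose y hy hst using fun o : orbitRel.Quotient (H × G) X => exists_point o
  let u : ∀ o : orbitRel.Quotient (H × G) X, (H × G) ⧸ (stabClass o).out → X := fun o q =>
    Quotient.liftOn' q (fun a => a • y o) (by
      intro a b hab
      rw [QuotientGroup.leftRel_apply, ← hst o, mem_stabilizer_iff, mul_smul,
        inv_smul_eq_iff] at hab
      exact hab.symm)
  refine ⟨u, ?_, ?_, ?_⟩
  · intro o a w
    induction w using Quotient.inductionOn' with | _ b
    exact mul_smul a b (y o)
  · rintro ⟨o, w⟩ ⟨o', w'⟩ h
    induction w using Quotient.inductionOn' with | _ a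
    induction w' using Quotient.inductionOn' with | _ b
    have h : a • y o = b • y o' := h
    have ho : o = o' := by
      rw [← hy o, ← hy o']
      refine Quotient.sound ⟨a⁻¹ * b, ?_⟩
      change (a⁻¹ * b) • y o' = y o
      rw [mul_smul, ← h, inv_smul_smul]
    subst ho
    congr 1
    refine Quotient.sound' ?_
    rw [QuotientGroup.leftRel_apply, ← hst o, mem_stabilizer_iff, mul_smul, ← h, inv_smul_smul]
  · intro x
    obtain ⟨a, ha⟩ : x ∈ orbit (H × G) (y (Quotient.mk _ x)) :=
      Quotient.exact (hy (Quotient.mk _ x)).symm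
    exact ⟨⟨Quotient.mk _ x, Quotient.mk'' a⟩, ha⟩

end Burnside

/-! ### Composition -/

section Tensor

variable (G H K : Type*) [Group G] [Group H] [Group K]
variable (X Y : Type*) [MulAction (G × H) X] [MulAction (H × K) Y]

/-- The orbit relation of `H` on `X × Y`, where `h` sends `(x, y)` to `((1, h) • x, (h, 1) • y)`. -/
def tensorSetoid : Setoid (X × Y) where
  r s t := ∃ h : H, ((1, h) : G × H) • s.1 = t.1 ∧ ((h, 1) : H × K) • s.2 = t.2
  iseqv :=
    { refl := fun s => ⟨1, one_smul _ s.1, one_smul _ s.2⟩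
      symm := by
        rintro ⟨x, y⟩ ⟨_, _⟩ ⟨h, rfl, rfl⟩
        exact ⟨h⁻¹, by simp [smul_smul, ← Prod.one_eq_mk], by simp [smul_smul, ← Prod.one_eq_mk]⟩
      trans := by
        rintro ⟨x, y⟩ ⟨_, _⟩ ⟨_, _⟩ ⟨h, rfl, rfl⟩ ⟨h', rfl, rfl⟩
        exact ⟨h' * h, by simp [smul_smul], by simp [smul_smul]⟩ }

/-- The `G × K`-set `X ×_H Y` of the `H`-orbits on `X × Y`. -/
def Tensor : Type _ := Quotient (tensorSetoid G H K X Y)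

variable {X Y}

/-- The orbit of `(x, y)` in `X ×_H Y`. -/
def Tensor.mk (x : X) (y : Y) : Tensor G H K X Y := Quotient.mk (tensorSetoid G H K X Y) (x, y)

variable {G H K}

theorem Tensor.mk_eq {x x' : X} {y y' : Y} : Tensor.mk G H K x y = Tensor.mk G H K x' y' ↔
    ∃ h : H, ((1, h) : G × H) • x = x' ∧ ((h, 1) : H × K) • y = y' :=
  Quotient.eq (r := tensorSetoid G H K X Y)

theorem Tensor.ind {p : Tensor G H K X Y → Prop} (h : ∀ x y, p (Tensor.mk G H K x y)) (t) : p t :=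
  Quotient.ind (fun s => h s.1 s.2) t

/-- Maps out of `X ×_H Y`. -/
def Tensor.lift {Z : Type*} (f : X → Y → Z)
    (hf : ∀ (h : H) x y, f (((1, h) : G × H) • x) (((h, 1) : H × K) • y) = f x y) :
    Tensor G H K X Y → Z :=
  Quotient.lift (fun s : X × Y => f s.1 s.2) (by
    rintro ⟨x, y⟩ ⟨_, _⟩ ⟨h, rfl, rfl⟩
    exact (hf h x y).symm)

instance Tensor.instMulAction : MulAction (G × K) (Tensor G H K X Y) where
  smul a := Tensor.lift
    (fun x y => Tensor.mk G H K (((a.1, 1) : G × H) • x) (((1, a.2) : H × K) • y)) (by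
      intro h x y
      exact (Tensor.mk_eq.2 ⟨h, by simp [smul_smul], by simp [smul_smul]⟩).symm)
  one_smul t := by
    induction t using Tensor.ind with | _ x y
    change Tensor.mk G H K ((1 : G × H) • x) ((1 : H × K) • y) = _
    simp
  mul_smul a b t := by
    induction t using Tensor.ind with | _ x y
    change Tensor.mk G H K _ _ = Tensor.mk G H K _ _
    simp [smul_smul]

theorem Tensor.smul_mk (a : G × K) (x : X) (y : Y) : a • Tensor.mk G H K x y =
    Tensor.mk G H K (((a.1, 1) : G × H) • x) (((1, a.2) : H × K) • y) := rfl

instance [Finite X] [Finite Y] : Finite (Tensor G H K X Y) := Quotient.finite _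

end Tensor

section Comp

variable {G H K L : Type*} [Group G] [Group H] [Group K] [Group L]

/-- The biadditive composition of double Burnside modules, given on the canonical bases by the
composition of functors, that is, by the bisets `X ×_H Y`. -/
noncomputable def comp : Burnside G H →+ Burnside H K →+ Burnside G K :=
  Burnside.extend fun c => Burnside.extend fun d =>
    bisetClass G K (Tensor G H K ((G × H) ⧸ c.out) ((H × K) ⧸ d.out))

theorem comp_basis (c : SubgroupConjClass (G × H)) (d : SubgroupConjClass (H × K)) :
    comp (Burnside.basis c) (Burnside.basis d) =
      bisetClass G K (Tensor G H K ((G × H) ⧸ c.out) ((H × K) ⧸ d.out)) := by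
  rw [comp, Burnside.extend_basis, Burnside.extend_basis]

/-- Composition of the classes of two finite bisets. -/
theorem comp_bisetClass (X Y : Type*) [MulAction (G × H) X] [MulAction (H × K) Y]
    [Finite X] [Finite Y] :
    comp (bisetClass G H X) (bisetClass H K Y) = bisetClass G K (Tensor G H K X Y) := by
  obtain ⟨u, hu, hub⟩ := exists_decomp (H := G) (G := H) X
  obtain ⟨v, hv, hvb⟩ := exists_decomp (H := H) (G := K) Y
  have : Finite (orbitRel.Quotient (G × H) X) := Quotient.finite _
  have : Finite (orbitRel.Quotient (H × K) Y) := Quotient.finite _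
  rw [bisetClass_decomp (I := orbitRel.Quotient (G × H) X × orbitRel.Quotient (H × K) Y)
    (W := fun i => Tensor G H K ((G × H) ⧸ (stabClass i.1).out) ((H × K) ⧸ (stabClass i.2).out))
    (fun i => Tensor.lift (fun a b => Tensor.mk G H K (u i.1 a) (v i.2 b)) (by
      intro h x y
      rw [hu, hv]
      exact (Tensor.mk_eq.2 ⟨h, rfl, rfl⟩).symm))]
  · have := Fintype.ofFinite (orbitRel.Quotient (G × H) X)
    have := Fintype.ofFinite (orbitRel.Quotient (H × K) Y)
    rw [finsum_eq_sum_of_fintype, Fintype.sum_prod_type]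
    conv_lhs => rw [bisetClass, bisetClass, finsum_eq_sum_of_fintype, finsum_eq_sum_of_fintype]
    simp only [map_sum, AddMonoidHom.finsetSum_apply, comp_basis]
    exact Finset.sum_comm
  · intro i a w
    induction w using Tensor.ind with | _ x y
    change Tensor.mk G H K (u i.1 _) (v i.2 _) = Tensor.mk G H K _ _
    rw [hu, hv]
  · constructor
    · rintro ⟨⟨o, o'⟩, w⟩ ⟨⟨q, q'⟩, w'⟩ h
      induction w using Tensor.ind with | _ x y
      induction w' using Tensor.ind with | _ x' y'
      obtain ⟨b, h1, h2⟩ := Tensor.mk_eq.1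
        (show Tensor.mk G H K (u o x) (v o' y) = Tensor.mk G H K (u q x') (v q' y') from h)
      rw [← hu] at h1
      rw [← hv] at h2
      have e1 := hub.1 (a₁ := ⟨o, _⟩) (a₂ := ⟨q, x'⟩) h1
      have e2 := hvb.1 (a₁ := ⟨o', _⟩) (a₂ := ⟨q', y'⟩) h2
      obtain ⟨rfl, e1⟩ := Sigma.mk.inj_iff.1 e1
      obtain ⟨rfl, e2⟩ := Sigma.mk.inj_iff.1 e2
      congr 1
      exact Tensor.mk_eq.2 ⟨b, eq_of_heq e1, eq_of_heq e2⟩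
    · intro t
      induction t using Tensor.ind with | _ x y
      obtain ⟨⟨o, a⟩, rfl⟩ := hub.2 x
      obtain ⟨⟨o', b⟩, rfl⟩ := hvb.2 y
      exact ⟨⟨(o, o'), Tensor.mk G H K a b⟩, rfl⟩

theorem comp_assoc [Finite G] [Finite H] [Finite K] [Finite L]
    (a : Burnside G H) (b : Burnside H K) (c : Burnside K L) :
    comp (comp a b) c = comp a (comp b c) := by
  refine Burnside.induction
    (p := fun a => comp (comp a b) c = comp a (comp b c)) a ?_ (by simp) ?_ ?_
  rotate_left
  · intro x y hx hy; simp [hx, hy]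
  · intro x hx; simp [hx]
  intro ca
  refine Burnside.induction (p := fun b => comp (comp (Burnside.basis ca) b) c =
    comp (Burnside.basis ca) (comp b c)) b ?_ (by simp) ?_ ?_
  rotate_left
  · intro x y hx hy; simp [hx, hy]
  · intro x hx; simp [hx]
  intro cb
  refine Burnside.induction (p := fun c => comp (comp (Burnside.basis ca) (Burnside.basis cb)) c =
    comp (Burnside.basis ca) (comp (Burnside.basis cb) c)) c ?_ (by simp) ?_ ?_
  rotate_left
  · intro x y hx hy; simp [hx, hy]
  · intro x hx; simp [hx]
  intro cc
  rw [basis_eq ca, basis_eq cb, basis_eq cc]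
  generalize ca.out = A, cb.out = B, cc.out = C
  have : Finite ((G × H) ⧸ A) := Quotient.finite _
  have : Finite ((H × K) ⧸ B) := Quotient.finite _
  have : Finite ((K × L) ⧸ C) := Quotient.finite _
  rw [comp_bisetClass, comp_bisetClass, comp_bisetClass, comp_bisetClass]
  refine bisetClass_congr
    (Tensor.lift (fun x t => Tensor.lift
      (fun y z => Tensor.mk G K L (Tensor.mk G H K x y) z) ?_ t) ?_) ?_ ⟨?_, ?_⟩
  · intro k y z
    refine (Tensor.mk_eq.2 ⟨k, ?_, rfl⟩).symm
    rw [Tensor.smul_mk]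
    exact congrArg (fun w => Tensor.mk G H K w _) (one_smul (G × H) x)
  · intro h x t
    induction t using Tensor.ind with | _ y z
    change Tensor.mk G K L (Tensor.mk G H K _ _) _ = Tensor.mk G K L (Tensor.mk G H K _ _) _
    congr 1
    · exact (Tensor.mk_eq.2 ⟨h, rfl, rfl⟩).symm
    · exact one_smul _ z
  · intro a t
    induction t using Tensor.ind with | _ x t
    induction t using Tensor.ind with | _ y z
    change Tensor.mk G K L (Tensor.mk G H K (((a.1, 1) : G × H) • x) (((1, 1) : H × K) • y)) _ =
      Tensor.mk G K L (Tensor.mk G H K (((a.1, 1) : G × H) • x) (((1, 1) : H × K) • y)) _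
    rfl
  · intro s t h
    induction s using Tensor.ind with | _ x s
    induction s using Tensor.ind with | _ y z
    induction t using Tensor.ind with | _ x' t
    induction t using Tensor.ind with | _ y' z'
    obtain ⟨k, h1, h2⟩ := Tensor.mk_eq.1
      (show Tensor.mk G K L (Tensor.mk G H K x y) z = Tensor.mk G K L (Tensor.mk G H K x' y') z'
        from h)
    rw [Tensor.smul_mk] at h1
    obtain ⟨l, h3, h4⟩ := Tensor.mk_eq.1 h1
    refine Tensor.mk_eq.2 ⟨l, ?_, ?_⟩
    · rw [← h3]; exact congrArg (((1, l) : G × H) • ·) (one_smul (G × H) x).symm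
    · rw [Tensor.smul_mk]
      refine Tensor.mk_eq.2 ⟨k, ?_, ?_⟩
      · rw [← h4]; simp [smul_smul]
      · rw [← h2]; exact congrArg (((k, 1) : K × L) • ·) (one_smul (K × L) z)
  · intro t
    induction t using Tensor.ind with | _ t z
    induction t using Tensor.ind with | _ x y
    exact ⟨Tensor.mk G H L x (Tensor.mk H K L y z), rfl⟩

/-- The underlying set `G` of the biset of a restriction functor. -/
@[ext]
structure ResBiset {H G : Type*} [Group H] [Group G] (α : H →* G) where
  val : G

instance {H G : Type*} [Group H] [Group G] (α : H →* G) : MulAction (H × G) (ResBiset α) where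
  smul a v := ⟨α a.1 * v.val * a.2⁻¹⟩
  one_smul v := ResBiset.ext (show (α 1 * v.val * 1⁻¹ : G) = v.val by simp)
  mul_smul a b v := ResBiset.ext (show (α (a.1 * b.1) * v.val * (a.2 * b.2)⁻¹ : G) =
    α a.1 * (α b.1 * v.val * b.2⁻¹) * a.2⁻¹ by simp [mul_assoc])

instance {H G : Type*} [Group H] [Group G] [Finite G] (α : H →* G) : Finite (ResBiset α) :=
  Finite.of_injective ResBiset.val fun _ _ h => ResBiset.ext h

theorem ResBiset.smul_val {H G : Type*} [Group H] [Group G] (α : H →* G) (a : H × G)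
    (v : ResBiset α) : (a • v).val = α a.1 * v.val * a.2⁻¹ := rfl

/-- The element `res_α` given by restriction along `α : H → G`, that is, by the `H × G`-set `G`
where `(h, g)` sends `v` to `α h * v * g⁻¹`. -/
noncomputable def res {H G : Type*} [Group H] [Group G] (α : H →* G) : Burnside H G :=
  bisetClass H G (ResBiset α)

theorem res_comp [Finite G] [Finite H] (α : K →* H) (β : H →* G) :
    comp (res α) (res β) = res (β.comp α) := by
  rw [res, res, comp_bisetClass]
  refine (bisetClass_congr (Tensor.lift (Z := ResBiset (β.comp α))
    (fun (v : ResBiset α) (w : ResBiset β) => ⟨β v.val * w.val⟩) ?_) ?_ ⟨?_, ?_⟩).symm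
  · intro h v w
    simp [ResBiset.smul_val, mul_assoc]
  · intro a t
    induction t using Tensor.ind with | _ v w
    refine ResBiset.ext ?_
    change (β (α a.1 * v.val * 1⁻¹) * (β 1 * w.val * a.2⁻¹) : G) =
      β (α a.1) * (β v.val * w.val) * a.2⁻¹
    simp [mul_assoc]
  · intro s t h
    induction s using Tensor.ind with | _ v w
    induction t using Tensor.ind with | _ v' w'
    have h : (β v.val * w.val : G) = β v'.val * w'.val := congrArg ResBiset.val h
    refine Tensor.mk_eq.2 ⟨v'.val⁻¹ * v.val, ResBiset.ext ?_, ResBiset.ext ?_⟩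
    · simp [ResBiset.smul_val]
    · rw [ResBiset.smul_val, map_mul, mul_assoc, mul_assoc, inv_one, mul_one, h]
      simp
  · intro w
    exact ⟨Tensor.mk _ _ _ ⟨1⟩ ⟨w.val⟩, ResBiset.ext (show (β 1 * w.val : G) = w.val by simp)⟩

theorem res_id_comp [Finite G] [Finite H] (x : Burnside G H) :
    comp (res (MonoidHom.id G)) x = x := by
  refine Burnside.induction
    (p := fun x => comp (res (MonoidHom.id G)) x = x) x ?_ (by simp) ?_ ?_
  rotate_left
  · intro x y hx hy; simp [hx, hy]
  · intro x hx; simp [hx]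
  intro c
  rw [basis_eq c]
  generalize c.out = D
  have : Finite ((G × H) ⧸ D) := Quotient.finite _
  rw [res, comp_bisetClass]
  refine (bisetClass_congr (Tensor.lift (Z := (G × H) ⧸ D)
    (fun v x => ((v.val, 1) : G × H) • x) ?_) ?_ ⟨?_, ?_⟩).symm
  · intro h v x
    simp [ResBiset.smul_val, smul_smul]
  · intro a t
    induction t using Tensor.ind with | _ v x
    change ((a.1 * v.val * 1⁻¹, 1) : G × H) • (((1, a.2) : G × H) • x) =
      a • (((v.val, 1) : G × H) • x)
    rw [smul_smul, smul_smul]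
    congr 1
    ext <;> simp
  · intro s t h
    induction s using Tensor.ind with | _ v x
    induction t using Tensor.ind with | _ v' x'
    have h : ((v.val, 1) : G × H) • x = ((v'.val, 1) : G × H) • x' := h
    refine Tensor.mk_eq.2 ⟨v'.val⁻¹ * v.val, ResBiset.ext ?_, ?_⟩
    · simp [ResBiset.smul_val]
    · have e : ((v'.val⁻¹ * v.val, 1) : G × H) =
          ((v'.val, 1) : G × H)⁻¹ * ((v.val, 1) : G × H) := by
        ext <;> simp
      rw [e, mul_smul, h, inv_smul_smul]
  · intro x
    exact ⟨Tensor.mk _ _ _ ⟨1⟩ x, one_smul (G × H) x⟩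

theorem comp_res_id [Finite G] [Finite H] (x : Burnside G H) :
    comp x (res (MonoidHom.id H)) = x := by
  refine Burnside.induction
    (p := fun x => comp x (res (MonoidHom.id H)) = x) x ?_ (by simp) ?_ ?_
  rotate_left
  · intro x y hx hy; simp [hx, hy]
  · intro x hx; simp [hx]
  intro c
  rw [basis_eq c]
  generalize c.out = D
  have : Finite ((G × H) ⧸ D) := Quotient.finite _
  rw [res, comp_bisetClass]
  refine (bisetClass_congr (Tensor.lift (Z := (G × H) ⧸ D)
    (fun x v => ((1, v.val⁻¹) : G × H) • x) ?_) ?_ ⟨?_, ?_⟩).symm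
  · intro h x v
    simp [ResBiset.smul_val, smul_smul]
  · intro a t
    induction t using Tensor.ind with | _ x v
    change ((1, (1 * v.val * a.2⁻¹)⁻¹) : G × H) • (((a.1, 1) : G × H) • x) =
      a • (((1, v.val⁻¹) : G × H) • x)
    rw [smul_smul, smul_smul]
    congr 1
    ext <;> simp
  · intro s t h
    induction s using Tensor.ind with | _ x v
    induction t using Tensor.ind with | _ x' v'
    have h : ((1, v.val⁻¹) : G × H) • x = ((1, v'.val⁻¹) : G × H) • x' := h
    refine Tensor.mk_eq.2 ⟨v'.val * v.val⁻¹, ?_, ResBiset.ext ?_⟩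
    · have e : ((1, v'.val * v.val⁻¹) : G × H) =
          ((1, v'.val⁻¹) : G × H)⁻¹ * ((1, v.val⁻¹) : G × H) := by
        ext <;> simp
      rw [e, mul_smul, h, inv_smul_smul]
    · simp [ResBiset.smul_val]
  · intro x
    exact ⟨Tensor.mk _ _ _ x ⟨1⟩, show ((1, (1 : H)⁻¹) : G × H) • x = x by
      rw [inv_one]; exact one_smul (G × H) x⟩

end Comp

/-! ### The double Burnside algebra of `P` -/

section Algebra

variable {P : Type*} [Group P]

/-- The double Burnside `ℤ`-algebra of `P`; the product is induced by composition. -/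
noncomputable instance [Finite P] : Ring (Burnside P P) where
  __ := (inferInstance : AddCommGroup (Burnside P P))
  mul x y := comp x y
  one := res (MonoidHom.id P)
  mul_assoc := comp_assoc
  one_mul := res_id_comp
  mul_one := comp_res_id
  left_distrib x y z := map_add (comp x) y z
  right_distrib x y z := by
    change comp (x + y) z = comp x z + comp y z
    simp
  zero_mul x := by
    change comp 0 x = 0
    simp
  mul_zero x := map_zero (comp x)

theorem mul_def [Finite P] (x y : Burnside P P) : x * y = comp x y := rfl

theorem one_def [Finite P] : (1 : Burnside P P) = res (MonoidHom.id P) := rfl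

/-- The map `t`, `f ↦ f°`, exchanging both factors: `(P × P) / D` goes to `(P × P) / D°`, where `D°`
is the image of `D` under the exchange of coordinates. -/
noncomputable def opp : Burnside P P →+ Burnside P P :=
  Burnside.extend fun c =>
    Burnside.ofSubgroup (c.out.map (MulEquiv.prodComm : P × P ≃* P × P).toMonoidHom)

/-- The length `ℓ`, additively extending `ℓ((P × P) / D) = |(P × P) / D| / |P|`. The division is
exact whenever `{1} × P` acts freely on `(P × P) / D`, that is, on the subalgebra of the elements
preserving projective `P`-sets, which contains all Hecke algebras. -/
noncomputable def length : Burnside P P →+ ℤ :=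
  Burnside.extend fun c => ((c.out.index / Nat.card P : ℕ) : ℤ)

/-- `Δ_φ(Q) = {(φ u, u) | u ∈ Q}`. -/
def graph {Q : Subgroup P} (φ : Q →* P) : Subgroup (P × P) := (φ.prod Q.subtype).range

/-- The indecomposable element `f_{Q,φ}`, the class of `(P × P) / Δ_φ(Q)`. -/
noncomputable def indec {Q : Subgroup P} (φ : Q →* P) : Burnside P P :=
  Burnside.ofSubgroup (graph φ)

theorem one_eq_indec [Finite P] :
    (1 : Burnside P P) = indec (Subgroup.topEquiv : (⊤ : Subgroup P) ≃* P).toMonoidHom := by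
  rw [one_def, res, indec, ← bisetClass_quotient]
  refine (bisetClass_congr (Z := ResBiset (MonoidHom.id P)) (fun q => Quotient.liftOn' q
    (fun a => ⟨a.1 * a.2⁻¹⟩) ?_) ?_ ⟨?_, ?_⟩)
  · rintro ⟨a, b⟩ ⟨c, d⟩ h
    rw [QuotientGroup.leftRel_apply] at h
    obtain ⟨⟨u, _⟩, hu⟩ := h
    have h1 : u = a⁻¹ * c := congrArg Prod.fst hu
    have h2 : u = b⁻¹ * d := congrArg Prod.snd hu
    refine ResBiset.ext ?_
    change a * b⁻¹ = c * d⁻¹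
    rw [eq_mul_inv_iff_mul_eq, mul_assoc, ← h2, h1, mul_inv_cancel_left]
  · intro a q
    induction q using Quotient.inductionOn' with | _ b
    refine ResBiset.ext ?_
    change (a.1 * b.1) * (a.2 * b.2)⁻¹ = a.1 * (b.1 * b.2⁻¹) * a.2⁻¹
    simp [mul_assoc]
  · intro q r h
    induction q using Quotient.inductionOn' with | _ a
    induction r using Quotient.inductionOn' with | _ b
    have h : a.1 * a.2⁻¹ = b.1 * b.2⁻¹ := congrArg ResBiset.val h
    refine Quotient.sound' ?_
    rw [QuotientGroup.leftRel_apply]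
    refine ⟨⟨a.1⁻¹ * b.1, trivial⟩, Prod.ext rfl ?_⟩
    change a.1⁻¹ * b.1 = a.2⁻¹ * b.2
    rw [mul_inv_eq_iff_eq_mul] at h
    rw [h]
    simp [mul_assoc]
  · intro v
    exact ⟨Quotient.mk'' (v.val, 1), ResBiset.ext (by change v.val * 1⁻¹ = v.val; simp)⟩

end Algebra

/-! ### Divisible and Frobenius `P`-categories -/

/-- A divisible `P`-category: a subcategory of the category of finite groups whose objects are the
subgroups of `P`, all of whose morphisms are injective, which contains the conjugations by elements
of `P`, and such that, for every `Q`, the category of its morphisms to `Q` is a full subcategory of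
the category of group homomorphisms to `Q`. (The identities are conjugations by `1`.) -/
@[ext]
structure DivisibleCategory (P : Type*) [Group P] where
  /-- The set of morphisms from `Q` to `R`. -/
  hom : ∀ Q R : Subgroup P, Set (Q →* R)
  comp_mem : ∀ {Q R T : Subgroup P} {φ : Q →* R} {ψ : R →* T},
    φ ∈ hom Q R → ψ ∈ hom R T → ψ.comp φ ∈ hom Q T
  conj_mem : ∀ {Q R : Subgroup P} (x : P) (φ : Q →* R),
    (∀ u : Q, (φ u : P) = x * u * x⁻¹) → φ ∈ hom Q R
  injective : ∀ {Q R : Subgroup P} {φ : Q →* R}, φ ∈ hom Q R → Function.Injective φ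
  full : ∀ {Q R T : Subgroup P} {φ : R →* Q} {ψ : T →* Q} {θ : R →* T},
    φ ∈ hom R Q → ψ ∈ hom T Q → ψ.comp θ = φ → θ ∈ hom R T

/-- The Frobenius category of `P`: the morphisms are those induced by conjugations in `P`. -/
def innerCategory (P : Type*) [Group P] : DivisibleCategory P where
  hom Q R := {φ | ∃ x : P, ∀ u : Q, (φ u : P) = x * u * x⁻¹}
  comp_mem := by
    rintro Q R T φ ψ ⟨x, hx⟩ ⟨y, hy⟩
    exact ⟨y * x, fun u => by rw [MonoidHom.comp_apply, hy, hx]; simp [mul_assoc]⟩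
  conj_mem x φ h := ⟨x, h⟩
  injective := by
    rintro Q R φ ⟨x, hx⟩ u v h
    have : x * (u : P) * x⁻¹ = x * v * x⁻¹ := by rw [← hx, ← hx, h]
    exact Subtype.ext (by simpa using this)
  full := by
    rintro Q R T φ ψ θ ⟨x, hx⟩ ⟨y, hy⟩ h
    refine ⟨y⁻¹ * x, fun u => ?_⟩
    have : y * (θ u : P) * y⁻¹ = x * u * x⁻¹ := by rw [← hy, ← hx, ← h]; rfl
    calc (θ u : P) = y⁻¹ * (y * (θ u : P) * y⁻¹) * y := by group
      _ = _ := by rw [this]; group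

namespace DivisibleCategory

variable {P : Type*} [Group P] (F : DivisibleCategory P)

/-- The set `F(P, Q)` of the morphisms from `Q` to `P`. -/
def toP (Q : Subgroup P) : Set (Q →* P) :=
  {φ | (Subgroup.topEquiv : (⊤ : Subgroup P) ≃* P).symm.toMonoidHom.comp φ ∈ F.hom Q ⊤}

/-- The group `F(Q)` of the `F`-automorphisms of `Q`. -/
def aut (Q : Subgroup P) : Subgroup (MulAut Q) where
  carrier := {σ | MulEquiv.toMonoidHom σ ∈ F.hom Q Q}
  mul_mem' := fun {_ _} h h' => F.comp_mem h' h
  one_mem' := F.conj_mem 1 _ (fun u => by simp)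
  inv_mem' := fun {σ} h => F.full (φ := MonoidHom.id Q) (ψ := MulEquiv.toMonoidHom σ)
    (F.conj_mem 1 _ (fun u => by simp)) h (by ext u; simp)

/-- The converse image `N` in `P` of `F_P(Q) ∩ ^{φ*}F_P(φ(Q))`: the elements of `N_P(Q)` whose
conjugation on `Q` corresponds through `φ` to the conjugation on `φ(Q)` by an element of
`N_P(φ(Q))`. -/
def extender {Q : Subgroup P} (φ : Q →* P) : Subgroup P where
  carrier := {u | u ∈ Subgroup.normalizer (Q : Set P) ∧
    ∃ v ∈ Subgroup.normalizer (φ.range : Set P),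
      ∀ x y : Q, (y : P) = u * x * u⁻¹ → φ y = v * φ x * v⁻¹}
  one_mem' := ⟨one_mem _, 1, one_mem _, fun x y h => by
    have : y = x := Subtype.ext (by simpa using h)
    simp [this]⟩
  mul_mem' := by
    rintro a b ⟨ha, v, hv, h⟩ ⟨hb, w, hw, h'⟩
    refine ⟨mul_mem ha hb, v * w, mul_mem hv hw, fun x y hxy => ?_⟩
    rw [h ⟨b * x * b⁻¹, (Subgroup.mem_normalizer_iff.1 hb x).1 x.2⟩ y
      (by simp [hxy, mul_assoc]), h' x _ rfl]
    simp [mul_assoc]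
  inv_mem' := by
    rintro a ⟨ha, v, hv, h⟩
    refine ⟨inv_mem ha, v⁻¹, inv_mem hv, fun x y hxy => ?_⟩
    rw [h y x (by simp [hxy, mul_assoc])]
    simp [mul_assoc]

theorem le_extender {Q : Subgroup P} (φ : Q →* P) : Q ≤ extender φ := fun u hu =>
  ⟨Subgroup.le_normalizer hu, φ ⟨u, hu⟩, Subgroup.le_normalizer ⟨⟨u, hu⟩, rfl⟩, fun x y h => by
    have : y = ⟨u, hu⟩ * x * ⟨u, hu⟩⁻¹ := Subtype.ext (by simpa using h)
    simp [this]⟩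

/-- The condition that `ζ(C_P(φ(Q))) = C_P(ζ(φ(Q)))` for every `F`-morphism `ζ` from
`φ(Q) C_P(φ(Q))` to `P`, stated for a subgroup `T` in place of `φ(Q)`. -/
def FullyCentralized (T : Subgroup P) : Prop :=
  ∀ ζ ∈ F.toP (T ⊔ Subgroup.centralizer (T : Set P)),
    ((Subgroup.centralizer (T : Set P)).subgroupOf (T ⊔ Subgroup.centralizer (T : Set P))).map ζ =
      Subgroup.centralizer
        ((T.subgroupOf (T ⊔ Subgroup.centralizer (T : Set P))).map ζ : Set P)

/-- A divisible `P`-category is a Frobenius `P`-category when `F_P(P)` is a Sylow `p`-subgroup of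
`F(P)` and every `F`-morphism `φ : Q → P` with `φ(Q)` fully centralized extends to an `F`-morphism
from the converse image in `P` of `F_P(Q) ∩ ^{φ*}F_P(φ(Q))`. -/
def IsFrobenius (p : ℕ) : Prop :=
  (∃ S : Sylow p (F.aut ⊤),
    (S : Subgroup (F.aut ⊤)) = ((innerCategory P).aut ⊤).subgroupOf (F.aut ⊤)) ∧
  ∀ (Q : Subgroup P), ∀ φ ∈ F.toP Q, F.FullyCentralized φ.range →
    ∃ ψ ∈ F.toP (extender φ), ψ.comp (Subgroup.inclusion (le_extender φ)) = φ

variable [Finite P]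

theorem indec_mul_indec_mem {Q R : Subgroup P} {φ : Q →* P} {ψ : R →* P}
    (hφ : φ ∈ F.toP Q) (hψ : ψ ∈ F.toP R) :
    indec φ * indec ψ ∈ AddSubgroup.closure
      {x : Burnside P P | ∃ (Q : Subgroup P), ∃ φ ∈ F.toP Q, x = indec φ} := by
  have : Finite ((P × P) ⧸ graph φ) := Quotient.finite _
  have : Finite ((P × P) ⧸ graph ψ) := Quotient.finite _
  rw [mul_def, indec, indec, ← bisetClass_quotient, ← bisetClass_quotient, comp_bisetClass]
  have : Finite (orbitRel.Quotient (P × P)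
    (Tensor P P P ((P × P) ⧸ graph φ) ((P × P) ⧸ graph ψ))) := Quotient.finite _
  have := Fintype.ofFinite (orbitRel.Quotient (P × P)
    (Tensor P P P ((P × P) ⧸ graph φ) ((P × P) ⧸ graph ψ)))
  rw [bisetClass, finsum_eq_sum_of_fintype]
  refine AddSubgroup.sum_mem _ fun o _ => AddSubgroup.subset_closure ?_
  -- every orbit contains a point `[Δ_φ(Q), (w, 1) Δ_ψ(R)]`
  obtain ⟨w, rfl⟩ : ∃ w : P, Quotient.mk (orbitRel (P × P) _)
      (Tensor.mk P P P ((1 : P × P) : (P × P) ⧸ graph φ)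
        (((w, 1) : P × P) : (P × P) ⧸ graph ψ)) = o := by
    induction o using Quotient.inductionOn' with | _ t
    induction t using Tensor.ind with | _ x y
    induction x using Quotient.inductionOn' with | _ a
    induction y using Quotient.inductionOn' with | _ b
    refine ⟨a.2⁻¹ * b.1, Quotient.sound ⟨(a.1⁻¹, b.2⁻¹), ?_⟩⟩
    refine Tensor.mk_eq.2 ⟨a.2⁻¹, ?_, ?_⟩
    · rw [smul_smul]
      refine congrArg (Quotient.mk'' : P × P → (P × P) ⧸ graph φ) ?_
      ext <;> simp
    · rw [smul_smul]
      refine congrArg (Quotient.mk'' : P × P → (P × P) ⧸ graph ψ) ?_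
      ext <;> simp
  let cψ : R →* P := (MulAut.conj w).toMonoidHom.comp ψ
  let U : Subgroup P := (Q.comap cψ).map R.subtype
  have hU : U ≤ R := Subgroup.map_subtype_le _
  have hUQ : ∀ u : U, cψ (Subgroup.inclusion hU u) ∈ Q := by
    rintro ⟨_, ⟨r, hr, rfl⟩⟩
    exact hr
  let θ : U →* Q := (cψ.comp (Subgroup.inclusion hU)).codRestrict Q hUQ
  have hθ : θ ∈ F.hom U Q := by
    let e := (Subgroup.topEquiv : (⊤ : Subgroup P) ≃* P).symm.toMonoidHom
    have h1 : Subgroup.inclusion hU ∈ F.hom U R := F.conj_mem 1 _ fun u => by simp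
    have h2 : e.comp ((MulAut.conj w).toMonoidHom.comp
        (Subgroup.topEquiv : (⊤ : Subgroup P) ≃* P).toMonoidHom) ∈ F.hom ⊤ ⊤ :=
      F.conj_mem w _ fun u => rfl
    have h3 : e.comp Q.subtype ∈ F.hom Q ⊤ := F.conj_mem 1 _ fun u => by
      change (u : P) = _
      simp
    exact F.full (F.comp_mem (F.comp_mem h1 hψ) h2) h3 (by ext u; rfl)
  refine ⟨U, φ.comp θ, F.comp_mem hθ hφ, ?_⟩
  rw [indec, Burnside.ofSubgroup]
  congr 1
  change SubgroupConjClass.mk (stabilizer (P × P) _) = _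
  congr 1
  ext ⟨c, d⟩
  rw [mem_stabilizer_iff, Tensor.smul_mk, eq_comm, Tensor.mk_eq]
  have key1 : ∀ h : P, ((1, h) : P × P) • ((1 : P × P) : (P × P) ⧸ graph φ) =
      ((c, 1) : P × P) • ((1 : P × P) : (P × P) ⧸ graph φ) ↔ (c, h⁻¹) ∈ graph φ := by
    intro h
    rw [Quotient.smul_coe, Quotient.smul_coe, QuotientGroup.eq]
    simp
  have key2 : ∀ h : P, ((h, 1) : P × P) • (((w, 1) : P × P) : (P × P) ⧸ graph ψ) =
      ((1, d) : P × P) • (((w, 1) : P × P) : (P × P) ⧸ graph ψ) ↔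
      (w⁻¹ * h⁻¹ * w, d) ∈ graph ψ := by
    intro h
    rw [Quotient.smul_coe, Quotient.smul_coe, QuotientGroup.eq]
    simp [mul_assoc]
  simp only [key1, key2]
  constructor
  · rintro ⟨h, ⟨q, hq⟩, ⟨r, hr⟩⟩
    have q1 : φ q = c := congrArg Prod.fst hq
    have q2 : (q : P) = h⁻¹ := congrArg Prod.snd hq
    have r1 : ψ r = w⁻¹ * h⁻¹ * w := congrArg Prod.fst hr
    have r2 : (r : P) = d := congrArg Prod.snd hr
    have hc : cψ r = q := by
      change w * ψ r * w⁻¹ = q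
      rw [r1, q2]
      group
    have hr' : r ∈ Q.comap cψ := by
      change cψ r ∈ Q
      rw [hc]; exact q.2
    refine ⟨⟨r, ⟨r, hr', rfl⟩⟩, Prod.ext ?_ r2⟩
    change φ (θ _) = c
    rw [← q1]
    congr 1
    exact Subtype.ext hc
  · rintro ⟨u, hu⟩
    have u1 : φ (θ u) = c := congrArg Prod.fst hu
    have u2 : (u : P) = d := congrArg Prod.snd hu
    refine ⟨((θ u : Q) : P)⁻¹, ⟨θ u, Prod.ext u1 (inv_inv _).symm⟩,
      ⟨Subgroup.inclusion hU u, Prod.ext ?_ u2⟩⟩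
    change ψ (Subgroup.inclusion hU u) =
      w⁻¹ * ((w * ψ (Subgroup.inclusion hU u) * w⁻¹)⁻¹)⁻¹ * w
    group

/-- The Hecke `ℤ`-algebra `H_F` of `F`: the `ℤ`-subalgebra of the double Burnside algebra spanned by
the elements `f_{Q,φ}`, where `φ : Q → P` runs over the `F`-morphisms to `P`. -/
noncomputable def hecke : Subring (Burnside P P) where
  __ := AddSubgroup.closure
    {x : Burnside P P | ∃ (Q : Subgroup P), ∃ φ ∈ F.toP Q, x = indec φ}
  one_mem' := AddSubgroup.subset_closure
    ⟨⊤, _, F.conj_mem 1 _ (fun u => by simp), one_eq_indec⟩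
  mul_mem' := by
    intro x y hx hy
    refine AddSubgroup.closure_induction₂ (p := fun x y _ _ => x * y ∈ AddSubgroup.closure
      {x : Burnside P P | ∃ (Q : Subgroup P), ∃ φ ∈ F.toP Q, x = indec φ})
      ?_ ?_ ?_ ?_ ?_ ?_ ?_ hx hy
    · rintro _ _ ⟨Q, φ, hφ, rfl⟩ ⟨R, ψ, hψ, rfl⟩
      exact F.indec_mul_indec_mem hφ hψ
    · intro x _; rw [zero_mul]; exact zero_mem _
    · intro x _; rw [mul_zero]; exact zero_mem _
    · intro x y z _ _ _ h h'; rw [add_mul]; exact add_mem h h'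
    · intro x y z _ _ _ h h'; rw [mul_add]; exact add_mem h h'
    · intro x y _ _ h; rw [neg_mul]; exact neg_mem h
    · intro x y _ _ h; rw [mul_neg]; exact neg_mem h

/-- The elements `f` of the double Burnside algebra with `res_φ · f = res_{ι_Q} · f` and
`res_φ · f° = res_{ι_Q} · f°` for every subgroup `Q` and every `F`-morphism `φ : Q → P`. -/
noncomputable def invariants : AddSubgroup (Burnside P P) where
  carrier := {f | ∀ (Q : Subgroup P), ∀ φ ∈ F.toP Q,
    comp (res φ) f = comp (res Q.subtype) f ∧ comp (res φ) (opp f) = comp (res Q.subtype) (opp f)}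
  zero_mem' := by intro Q φ _; simp
  add_mem' := by
    intro x y hx hy Q φ hφ
    simp [hx Q φ hφ, hy Q φ hφ]
  neg_mem' := by
    intro x hx Q φ hφ
    simp [hx Q φ hφ]

/-- The invariants `H^F` of the Hecke algebra `H = H_F`. -/
noncomputable def heckeInvariants : AddSubgroup (Burnside P P) :=
  F.hecke.toAddSubgroup ⊓ F.invariants

end DivisibleCategory

section Element

variable {P : Type*} [Group P] [Finite P]

theorem res_conj {Q : Subgroup P} (x : P) (φ : Q →* P) (h : ∀ u, φ u = x * u * x⁻¹) :
    res φ = res Q.subtype := by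
  refine bisetClass_congr (fun v => ⟨x * v.val⟩) ?_ ⟨?_, ?_⟩
  · intro a v
    refine ResBiset.ext ?_
    change x * (a.1 * v.val * a.2⁻¹) = φ a.1 * (x * v.val) * a.2⁻¹
    rw [h]
    group
  · intro v w hvw
    exact ResBiset.ext (mul_left_cancel (congrArg ResBiset.val hvw))
  · intro v
    exact ⟨⟨x⁻¹ * v.val⟩, ResBiset.ext (mul_inv_cancel_left x v.val)⟩

/-- The divisible `P`-category `F^f`: the morphisms from `Q` to `P` are the injective group
homomorphisms `φ` with `res_φ · f = res_{ι_Q} · f` and `res_φ · f° = res_{ι_Q} · f°`, and the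
morphisms from `Q` to `R` are those whose composite with the inclusion of `R` is of this kind. -/
noncomputable def stabilizerCategory (f : Burnside P P) : DivisibleCategory P where
  hom Q R := {φ | Function.Injective φ ∧
    comp (res (R.subtype.comp φ)) f = comp (res Q.subtype) f ∧
    comp (res (R.subtype.comp φ)) (opp f) = comp (res Q.subtype) (opp f)}
  comp_mem := by
    rintro Q R T φ ψ ⟨i, h1, h2⟩ ⟨j, h3, h4⟩
    refine ⟨j.comp i, ?_, ?_⟩
    · rw [← MonoidHom.comp_assoc, ← res_comp, comp_assoc, h3, ← comp_assoc, res_comp, h1]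
    · rw [← MonoidHom.comp_assoc, ← res_comp, comp_assoc, h4, ← comp_assoc, res_comp, h2]
  conj_mem := by
    intro Q R x φ h
    refine ⟨(innerCategory P).injective ⟨x, h⟩, ?_, ?_⟩ <;> rw [res_conj x _ h]
  injective h := h.1
  full := by
    rintro Q R T φ ψ θ ⟨i, h1, h2⟩ ⟨j, h3, h4⟩ rfl
    refine ⟨Function.Injective.of_comp i, ?_, ?_⟩
    · rw [← h1, ← MonoidHom.comp_assoc, ← res_comp, ← res_comp, comp_assoc, comp_assoc, h3]
    · rw [← h2, ← MonoidHom.comp_assoc, ← res_comp, ← res_comp, comp_assoc, comp_assoc, h4]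

/-- The minimal Hecke algebra `H_f` containing `f`: the intersection of all of them. -/
noncomputable def minimalHecke (f : Burnside P P) : Subring (Burnside P P) :=
  sInf {H | (∃ F : DivisibleCategory P, H = F.hecke) ∧ f ∈ H}

end Element

end Puig

/-! The mark of an element `f` of the double Burnside algebra at a graph `Δ_φ(Q)` depends only on
`res_φ · f`; hence, if `f ∈ H_F` satisfies `res_φ · f = res_{ι_Q} · f` for all `φ ∈ F(P, Q)`, then
all these marks equal one integer `μ(Q)`, whereas the marks at the graphs of the other homomorphisms
`Q → P` vanish. Letting `P × Q` act on the sets `(P × P)/Δ_σ(R)`, on which `P × 1` acts freely,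
gives `|F(P, Q)| μ(Q) ≡ |P| ℓ(f)` modulo `p |P|`. If `ℓ(f)` is prime to `p`, this forces
`μ(Q) ≠ 0`, so that `F` is recovered from `f`.

The normalizer of `Δ_φ(Q)` acts on the fixed points of `Δ_φ(Q)`, and its subgroup
`C_P(φ(Q)) × 1` acts freely. So `|C_P(φ(Q))|` divides `μ(Q)`, and `p |C_P(φ(Q))|` divides it as well
unless some fixed point is fixed by a graph over the whole of the extender of `φ`, in which case `φ`
extends. By the congruence the latter must happen when `|C_P(φ(Q))|` is as large as possible, and
this is the case when `φ(Q)` is fully centralized. For `Q = P` the same divisibility, with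
`|F_P(P)| |Z(P)| = |P|`, shows that `F_P(P)` is a Sylow subgroup of `F(P)`.
-/

namespace Puig

open MulAction

section Counting

variable {A B : Type*} [Group A] [Group B]

theorem index_eq_card_ker_mul_relIndex [Finite A] {π : A →* B} {S : Subgroup A}
    (hS : Set.InjOn π S) : S.index = Nat.card π.ker * (S.map π).relIndex π.range := by
  have hmap : Nat.card (S.map π) = Nat.card S := Nat.card_image_of_injOn hS
  have hrange := Subgroup.relIndex_mul_relIndex ⊥ (S.map π) π.range bot_le
    (Subgroup.map_le_range π S)
  rw [Subgroup.relIndex_bot_left, Subgroup.relIndex_bot_left, hmap, ← Subgroup.index_ker] at hrange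
  have hA := π.ker.card_mul_index.trans S.card_mul_index.symm
  rw [← hrange, mul_left_comm] at hA
  exact (Nat.eq_of_mul_eq_mul_left Nat.card_pos hA).symm

theorem index_dvd_index_of_card_le [Finite A] {p : ℕ} [Fact p.Prime] (hA : IsPGroup p A)
    {S T : Subgroup A} (h : Nat.card S ≤ Nat.card T) : T.index ∣ S.index := by
  obtain ⟨m, hm⟩ := (hA.to_subgroup S).exists_card_eq
  obtain ⟨n, hn⟩ := (hA.to_subgroup T).exists_card_eq
  have hdvd : Nat.card S ∣ Nat.card T := by
    rw [hm, hn] at h ⊢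
    exact pow_dvd_pow p ((Nat.pow_le_pow_iff_right (Fact.out : p.Prime).one_lt).1 h)
  obtain ⟨k, hk⟩ := hdvd
  have hcard := S.card_mul_index.trans T.card_mul_index.symm
  rw [hk, mul_assoc] at hcard
  exact Dvd.intro_left k (Nat.eq_of_mul_eq_mul_left Nat.card_pos hcard).symm

variable {Z : Type*} [MulAction A Z] [Finite Z]

theorem dvd_card_of_dvd_index (d : ℕ) (h : ∀ z : Z, d ∣ (stabilizer A z).index) :
    d ∣ Nat.card Z := by
  have : Finite (orbitRel.Quotient A Z) := Quotient.finite _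
  have := Fintype.ofFinite (orbitRel.Quotient A Z)
  rw [Nat.card_congr (selfEquivSigmaOrbits A Z), Nat.card_sigma]
  refine Finset.dvd_sum fun o _ => ?_
  have := h (Quotient.out o)
  rwa [index_stabilizer] at this

variable [Finite A] {π : A →* B}

theorem card_ker_dvd_card (hπ : ∀ z : Z, Set.InjOn π (stabilizer A z)) :
    Nat.card π.ker ∣ Nat.card Z :=
  dvd_card_of_dvd_index (A := A) _ fun z =>
    ⟨_, index_eq_card_ker_mul_relIndex (hπ z)⟩

theorem card_modEq_card_range_le_map_stabilizer {p : ℕ} [Fact p.Prime] (hA : IsPGroup p A)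
    (hπ : ∀ z : Z, Set.InjOn π (stabilizer A z)) :
    Nat.card Z ≡ Nat.card {z : Z // π.range ≤ (stabilizer A z).map π}
      [MOD p * Nat.card π.ker] := by
  have hgood (z : Z) : π.range ≤ (stabilizer A z).map π ↔
      (orbit A z).ncard = Nat.card π.ker := by
    rw [← index_stabilizer, index_eq_card_ker_mul_relIndex (hπ z), ← Subgroup.relIndex_eq_one,
      Nat.mul_eq_left Nat.card_pos.ne']
  let bad : SubMulAction A Z :=
    { carrier := {z | ¬ π.range ≤ (stabilizer A z).map π}
      smul_mem' a z hz h := hz ((hgood z).2 (orbit_smul a z ▸ (hgood _).1 h)) }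
  have hbad : p * Nat.card π.ker ∣ Nat.card bad := by
    refine dvd_card_of_dvd_index (A := A) _ fun z => ?_
    rw [SubMulAction.stabilizer_of_subMul, index_eq_card_ker_mul_relIndex (hπ z), mul_comm]
    have : Finite π.range := Finite.of_surjective _ π.rangeRestrict_surjective
    obtain ⟨n, hn⟩ := (hA.of_surjective _ π.rangeRestrict_surjective).index
      (((stabilizer A (z : Z)).map π).subgroupOf π.range)
    have hn0 : n ≠ 0 := by
      rintro rfl
      exact z.2 (Subgroup.relIndex_eq_one.1 hn)
    rw [Subgroup.relIndex, hn]
    exact mul_dvd_mul_left _ (dvd_pow_self p hn0)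
  classical
  rw [← Nat.card_congr (Equiv.sumCompl fun z : Z => π.range ≤ (stabilizer A z).map π),
    Nat.card_sum]
  exact (Nat.ModEq.refl _).add (Nat.modEq_zero_iff_dvd.2 hbad)

end Counting

theorem card_ker_snd_comp_subtype {G H : Type*} [Group G] [Group H] (A : Subgroup (G × H)) :
    Nat.card ((MonoidHom.snd G H).comp A.subtype).ker =
      Nat.card (A.comap (MonoidHom.inl G H)) := by
  refine (Nat.card_congr (Equiv.ofBijective
    (fun g => ⟨⟨(g, 1), g.2⟩, rfl⟩) ⟨fun g h e => ?_, ?_⟩)).symm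
  · exact Subtype.ext (congrArg (fun k : MonoidHom.ker _ => (k : G × H).1) e)
  · rintro ⟨⟨⟨g, h⟩, hg⟩, hh : h = 1⟩
    subst hh
    exact ⟨⟨g, hg⟩, rfl⟩

section Mark

variable {H G K : Type*} [Group H] [Group G] [Group K]

section ResTensor

variable (φ : H →* G) {Y : Type*} [MulAction (G × K) Y]

theorem smul_mk_res_one (a : H × K) (y : Y) :
    a • Tensor.mk H G K (⟨1⟩ : ResBiset φ) y = Tensor.mk H G K ⟨1⟩ ((φ a.1, a.2) • y) := by
  rw [Tensor.smul_mk, Tensor.mk_eq]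
  exact ⟨φ a.1, ResBiset.ext (by simp [ResBiset.smul_val]), by simp [smul_smul]⟩

theorem bijective_mk_res_one :
    Function.Bijective fun y : Y => Tensor.mk H G K (⟨1⟩ : ResBiset φ) y := by
  refine ⟨fun x y h => ?_, fun t => ?_⟩
  · obtain ⟨g, hg, rfl⟩ := Tensor.mk_eq.1 h
    obtain rfl : g = 1 := by simpa [ResBiset.smul_val] using congrArg ResBiset.val hg
    exact (one_smul (G × K) x).symm
  · induction t using Tensor.ind with | _ v y
    exact ⟨((v.val, 1) : G × K) • y, (Tensor.mk_eq.2
      ⟨v.val, ResBiset.ext (by simp [ResBiset.smul_val]), rfl⟩).symm⟩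

theorem le_stabilizer_mk_res_one_iff {D : Subgroup (H × K)} {y : Y} :
    D ≤ stabilizer (H × K) (Tensor.mk H G K (⟨1⟩ : ResBiset φ) y) ↔
      D.map (φ.prodMap (MonoidHom.id K)) ≤ stabilizer (G × K) y := by
  rw [Subgroup.map_le_iff_le_comap]
  refine forall₂_congr fun a _ => ?_
  rw [mem_stabilizer_iff, smul_mk_res_one]
  exact (bijective_mk_res_one φ).1.eq_iff

end ResTensor

/-- The mark at a subgroup `D` of `H × G`: the additive extension to the Burnside module of the
number of fixed points of `D`, written here as the points whose stabilizer contains `D`. -/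
noncomputable def mark (D : Subgroup (H × G)) : Burnside H G →+ ℤ :=
  Burnside.extend fun c =>
    (Nat.card {x : (H × G) ⧸ c.out // D ≤ stabilizer (H × G) x} : ℤ)

variable [Finite H] [Finite G] [Finite K]

theorem mark_bisetClass (D : Subgroup (H × G)) (X : Type*) [MulAction (H × G) X] [Finite X] :
    mark D (bisetClass H G X) = Nat.card {x : X // D ≤ stabilizer (H × G) x} := by
  obtain ⟨u, hu, hb⟩ := exists_decomp (H := H) (G := G) X
  have hstab (o) (w : (H × G) ⧸ (stabClass o).out) :
      stabilizer (H × G) w = stabilizer (H × G) (u o w) := by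
    ext a
    rw [mem_stabilizer_iff, mem_stabilizer_iff, ← hu]
    exact (hb.1.comp sigma_mk_injective).eq_iff.symm
  have : Finite (orbitRel.Quotient (H × G) X) := Quotient.finite _
  have := Fintype.ofFinite (orbitRel.Quotient (H × G) X)
  calc mark D (bisetClass H G X)
      = ∑ o : orbitRel.Quotient (H × G) X,
          (Nat.card {w : (H × G) ⧸ (stabClass o).out // D ≤ stabilizer (H × G) w} : ℤ) := by
        rw [bisetClass, finsum_eq_sum_of_fintype, map_sum]
        simp only [mark, Burnside.extend_basis]
    _ = Nat.card {s : Σ o : orbitRel.Quotient (H × G) X, (H × G) ⧸ (stabClass o).out //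
          D ≤ stabilizer (H × G) s.2} := by
        rw [← Nat.cast_sum, ← Nat.card_sigma]
        exact congrArg _ (Nat.card_congr
          ⟨fun s => ⟨⟨s.1, s.2.1⟩, s.2.2⟩, fun s => ⟨s.1.1, s.1.2, s.2⟩,
            fun _ => rfl, fun _ => rfl⟩)
    _ = Nat.card {x : X // D ≤ stabilizer (H × G) x} :=
        congrArg _ (Nat.card_congr ((Equiv.ofBijective _ hb).subtypeEquiv fun s => by
          rw [hstab]; rfl))

theorem mark_comp_res (φ : H →* G) (D : Subgroup (H × K)) (x : Burnside G K) :
    mark D (comp (res φ) x) = mark (D.map (φ.prodMap (MonoidHom.id K))) x := by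
  refine DFunLike.congr_fun (f := (mark D).comp (comp (res φ))) (g := mark _)
    (Burnside.hom_ext fun c => ?_) x
  rw [AddMonoidHom.comp_apply, basis_eq c, res, comp_bisetClass, mark_bisetClass, mark_bisetClass]
  exact congrArg _ (Nat.card_congr ((Equiv.ofBijective _ (bijective_mk_res_one φ)).subtypeEquiv
    fun y => (le_stabilizer_mk_res_one_iff φ).symm)).symm

variable {P : Type*} [Group P] [Finite P] {Q R : Subgroup P}

theorem mark_graph_eq_mark_comp_res (φ : Q →* P) (f : Burnside P P) :
    mark (graph φ) f = mark ((MonoidHom.id Q).prod Q.subtype).range (comp (res φ) f) := by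
  rw [mark_comp_res, MonoidHom.map_range]
  rfl

theorem mark_indec (D : Subgroup (P × P)) (σ : R →* P) :
    mark D (indec σ) = Nat.card {x : (P × P) ⧸ graph σ // D ≤ stabilizer (P × P) x} := by
  rw [indec, ← bisetClass_quotient, mark_bisetClass]

end Mark

section Graph

variable {P : Type*} [Group P] {Q R : Subgroup P}

theorem graph_le_iff {φ : Q →* P} {D : Subgroup (P × P)} :
    graph φ ≤ D ↔ ∀ u : Q, (φ u, (u : P)) ∈ D := by
  rw [graph, MonoidHom.range_eq_map, Subgroup.map_le_iff_le_comap]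
  exact ⟨fun h u => h (Subgroup.mem_top u), fun h u _ => h u⟩

theorem exists_graph_le {D : Subgroup (P × P)} (hD : Set.InjOn Prod.snd (D : Set (P × P)))
    (hQ : Q ≤ D.map (MonoidHom.snd P P)) : ∃ ψ : Q →* P, graph ψ ≤ D := by
  let snd : D →* P := (MonoidHom.snd P P).comp D.subtype
  have hsnd : Function.Injective snd := hD.injective
  have hrange (u : Q) : (u : P) ∈ snd.range := by
    obtain ⟨d, hd, h⟩ := hQ u.2
    exact ⟨⟨d, hd⟩, h⟩
  let s : Q →* D :=
    (MonoidHom.ofInjective hsnd).symm.toMonoidHom.comp (Q.subtype.codRestrict _ hrange)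
  have hs (u : Q) : (s u : P × P).2 = u :=
    congrArg Subtype.val ((MonoidHom.ofInjective hsnd).apply_symm_apply ⟨u, hrange u⟩)
  refine ⟨(MonoidHom.fst P P).comp (D.subtype.comp s), graph_le_iff.2 fun u => ?_⟩
  convert (s u).2 using 1
  exact Prod.ext rfl (hs u).symm

theorem eq_of_graph_le {D : Subgroup (P × P)} (hD : Set.InjOn Prod.snd (D : Set (P × P)))
    {φ ψ : Q →* P} (hφ : graph φ ≤ D) (hψ : graph ψ ≤ D) : φ = ψ :=
  MonoidHom.ext fun u =>
    congrArg Prod.fst (hD (graph_le_iff.1 hφ u) (graph_le_iff.1 hψ u) rfl)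

theorem mem_stabilizer_mk_graph_iff {σ : R →* P} {y : P × P} {a : P × P} :
    a ∈ stabilizer (P × P) (y : (P × P) ⧸ graph σ) ↔
      ∃ r : R, a = y * (σ r, (r : P)) * y⁻¹ := by
  rw [mem_stabilizer_iff, eq_comm]
  change ((y : P × P) : (P × P) ⧸ graph σ) = ((a * y : P × P) : (P × P) ⧸ graph σ) ↔ _
  rw [QuotientGroup.eq]
  refine exists_congr fun r => ?_
  rw [eq_inv_mul_iff_mul_eq, eq_mul_inv_iff_mul_eq, eq_comm]
  rfl

theorem injOn_snd_stabilizer {σ : R →* P} (x : (P × P) ⧸ graph σ) :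
    Set.InjOn Prod.snd (stabilizer (P × P) x : Set (P × P)) := by
  induction x using QuotientGroup.induction_on with | _ y
  intro a ha b hb hab
  obtain ⟨r, rfl⟩ := mem_stabilizer_mk_graph_iff.1 ha
  obtain ⟨s, rfl⟩ := mem_stabilizer_mk_graph_iff.1 hb
  have : r = s := Subtype.ext (by simpa using hab)
  rw [this]

end Graph

section NormalizerGraph

variable {P : Type*} [Group P] [Finite P] {Q : Subgroup P} {φ : Q →* P}

theorem mem_normalizer_graph_iff {a : P × P} :
    a ∈ Subgroup.normalizer (graph φ : Set (P × P)) ↔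
      ∀ x : Q, ∃ y : Q, (y : P) = a.2 * x * a.2⁻¹ ∧ φ y = a.1 * φ x * a.1⁻¹ := by
  constructor
  · intro h x
    obtain ⟨y, hy⟩ := (Subgroup.mem_normalizer_iff.1 h (φ x, (x : P))).1 ⟨x, rfl⟩
    exact ⟨y, congrArg Prod.snd hy, congrArg Prod.fst hy⟩
  · intro h
    refine Subgroup.mem_normalizer_fintype ?_
    rintro _ ⟨x, rfl⟩
    obtain ⟨y, h1, h2⟩ := h x
    exact ⟨y, Prod.ext h2 h1⟩

theorem comap_inl_normalizer_graph :
    (Subgroup.normalizer (graph φ : Set (P × P))).comap (MonoidHom.inl P P) =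
      Subgroup.centralizer (φ.range : Set P) := by
  ext v
  have hcomm : v ∈ Subgroup.centralizer (φ.range : Set P) ↔ ∀ x : Q, φ x = v * φ x * v⁻¹ := by
    simp only [Subgroup.mem_centralizer_iff, eq_mul_inv_iff_mul_eq, SetLike.mem_coe,
      MonoidHom.mem_range, forall_exists_index, forall_apply_eq_imp_iff]
  rw [hcomm, Subgroup.mem_comap, mem_normalizer_graph_iff]
  refine forall_congr' fun x => ⟨?_, fun h => ⟨x, by simp, h⟩⟩
  rintro ⟨y, hy, h⟩
  obtain rfl : y = x := Subtype.ext (by simpa using hy)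
  exact h

theorem card_ker_snd_normalizer_graph (φ : Q →* P) :
    Nat.card ((MonoidHom.snd P P).comp
      (Subgroup.normalizer (graph φ : Set (P × P))).subtype).ker =
      Nat.card (Subgroup.centralizer (φ.range : Set P)) := by
  rw [card_ker_snd_comp_subtype, comap_inl_normalizer_graph]

theorem extender_le_map_snd_normalizer_graph : DivisibleCategory.extender φ ≤
    (Subgroup.normalizer (graph φ : Set (P × P))).map (MonoidHom.snd P P) := by
  rintro u ⟨hu, v, -, h⟩
  exact ⟨(v, u), mem_normalizer_graph_iff.2 fun x =>
    ⟨⟨u * x * u⁻¹, (Subgroup.mem_normalizer_iff.1 hu x).1 x.2⟩, rfl, h _ _ rfl⟩, rfl⟩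

end NormalizerGraph

theorem card_mul_length_indec {P : Type*} [Group P] [Finite P] {R : Subgroup P} (σ : R →* P) :
    (Nat.card P : ℤ) * length (indec σ) = Nat.card ((P × P) ⧸ graph σ) := by
  have hindex : (SubgroupConjClass.mk (graph σ)).out.index = (graph σ).index := by
    obtain ⟨a, ha⟩ := SubgroupConjClass.mk_eq_mk.1 (SubgroupConjClass.mk_out
      (SubgroupConjClass.mk (graph σ)))
    conv_rhs => rw [ha]
    exact (Subgroup.index_map_of_bijective (MulAut.conj a).bijective _).symm
  have hcard : Nat.card (graph σ) = Nat.card R :=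
    (Nat.card_congr (MonoidHom.ofInjective (f := σ.prod R.subtype) fun x y h =>
      Subtype.ext (congrArg Prod.snd h)).toEquiv).symm
  have hdvd : Nat.card P ∣ (graph σ).index := by
    have h := (graph σ).card_mul_index
    rw [hcard, Nat.card_prod, ← R.card_mul_index, mul_assoc, R.card_mul_index] at h
    exact ⟨R.index, (Nat.eq_of_mul_eq_mul_left Nat.card_pos h).trans (mul_comm _ _)⟩
  rw [indec, Burnside.ofSubgroup, length, Burnside.extend_basis, hindex, ← Nat.cast_mul,
    Nat.mul_div_cancel' hdvd]
  rfl

/-- The points fixed by a subgroup `D`, as a set acted on by the normalizer of `D`. -/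
def fixedSubset {A : Type*} [Group A] (D : Subgroup A) (Z : Type*) [MulAction A Z] :
    SubMulAction (Subgroup.normalizer (D : Set A)) Z where
  carrier := {z | D ≤ stabilizer A z}
  smul_mem' a z hz d hd := by
    have h : (a : A)⁻¹ * d * a ∈ stabilizer A z := hz ((Subgroup.mem_normalizer_iff''.1 a.2 d).1 hd)
    rw [mem_stabilizer_iff, mul_smul, mul_smul, inv_smul_eq_iff] at h
    exact h

theorem isPGroup_prod {G H : Type*} [Group G] [Group H] {p : ℕ} (hG : IsPGroup p G)
    (hH : IsPGroup p H) : IsPGroup p (G × H) := by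
  rintro ⟨g, h⟩
  obtain ⟨m, hm⟩ := hG g
  obtain ⟨n, hn⟩ := hH h
  refine ⟨m + n, Prod.ext ?_ ?_⟩
  · rw [Prod.pow_fst, pow_add, pow_mul, hm, one_pow, Prod.fst_one]
  · rw [Prod.pow_snd, pow_add, mul_comm, pow_mul, hn, one_pow, Prod.snd_one]

section FreeOnLeft

variable {P : Type*} [Group P] {Z : Type*} [MulAction (P × P) Z]

theorem injOn_snd_stabilizer_fixedSubset
    (hZ : ∀ z : Z, Set.InjOn Prod.snd (stabilizer (P × P) z : Set (P × P)))
    (D : Subgroup (P × P)) (z : fixedSubset D Z) :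
    Set.InjOn ((MonoidHom.snd P P).comp (Subgroup.normalizer (D : Set (P × P))).subtype)
      (stabilizer (Subgroup.normalizer (D : Set (P × P))) z) := fun _ ha _ hb h =>
  Subtype.ext (hZ z.1 (congrArg Subtype.val ha) (congrArg Subtype.val hb) h)

variable [Finite Z]

theorem sum_card_graph_le_stabilizer
    (hZ : ∀ z : Z, Set.InjOn Prod.snd (stabilizer (P × P) z : Set (P × P)))
    (Q : Subgroup P) [Fintype (Q →* P)] :
    ∑ ψ : Q →* P, Nat.card {z : Z // graph ψ ≤ stabilizer (P × P) z} =
      Nat.card {z : Z // Q ≤ (stabilizer (P × P) z).map (MonoidHom.snd P P)} := by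
  rw [← Nat.card_sigma]
  refine Nat.card_congr (Equiv.ofBijective
    (fun s => ⟨s.2.1, fun u hu => ⟨_, graph_le_iff.1 s.2.2 ⟨u, hu⟩, rfl⟩⟩) ⟨?_, ?_⟩)
  · rintro ⟨ψ, z, hψ⟩ ⟨ψ', z', hψ'⟩ h
    obtain rfl : z = z' := congrArg Subtype.val h
    obtain rfl := eq_of_graph_le (hZ z) hψ hψ'
    rfl
  · rintro ⟨z, hz⟩
    obtain ⟨ψ, hψ⟩ := exists_graph_le (hZ z) hz
    exact ⟨⟨ψ, z, hψ⟩, rfl⟩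

variable [Finite P] {p : ℕ} [Fact p.Prime] {Q : Subgroup P}

theorem sum_card_graph_le_stabilizer_modEq
    (hZ : ∀ z : Z, Set.InjOn Prod.snd (stabilizer (P × P) z : Set (P × P)))
    (hP : IsPGroup p P) (Q : Subgroup P) [Fintype (Q →* P)] :
    ∑ ψ : Q →* P, Nat.card {z : Z // graph ψ ≤ stabilizer (P × P) z} ≡
      Nat.card Z [MOD p * Nat.card P] := by
  let A : Subgroup (P × P) := (⊤ : Subgroup P).prod Q
  let π : A →* P := (MonoidHom.snd P P).comp A.subtype
  have hker : Nat.card π.ker = Nat.card P := by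
    have hcomap : A.comap (MonoidHom.inl P P) = ⊤ :=
      top_unique fun v _ => ⟨Subgroup.mem_top v, Q.one_mem⟩
    rw [card_ker_snd_comp_subtype, hcomap, Subgroup.card_top]
  have hgood (z : Z) : π.range ≤ (stabilizer A z).map π ↔
      Q ≤ (stabilizer (P × P) z).map (MonoidHom.snd P P) := by
    constructor
    · intro h u hu
      obtain ⟨a, ha, rfl⟩ := h ⟨⟨(1, u), Subgroup.mem_top _, hu⟩, rfl⟩
      exact ⟨a, ha, rfl⟩
    · rintro h _ ⟨a, rfl⟩
      obtain ⟨b, hb, hba : b.2 = a.1.2⟩ := h a.2.2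
      have hbQ : b.2 ∈ Q := by
        rw [hba]
        exact a.2.2
      exact ⟨⟨b, Subgroup.mem_top _, hbQ⟩, hb, hba⟩
  have hcount := card_modEq_card_range_le_map_stabilizer (Z := Z) (π := π)
    ((isPGroup_prod hP hP).to_subgroup A) fun z a ha b hb h => Subtype.ext (hZ z ha hb h)
  rw [hker, Nat.card_congr (Equiv.subtypeEquivRight hgood)] at hcount
  rw [sum_card_graph_le_stabilizer hZ]
  exact hcount.symm

theorem card_centralizer_dvd_card_graph_le_stabilizer
    (hZ : ∀ z : Z, Set.InjOn Prod.snd (stabilizer (P × P) z : Set (P × P))) (φ : Q →* P) :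
    Nat.card (Subgroup.centralizer (φ.range : Set P)) ∣
      Nat.card {z : Z // graph φ ≤ stabilizer (P × P) z} := by
  rw [← card_ker_snd_normalizer_graph]
  exact card_ker_dvd_card (Z := fixedSubset (graph φ) Z) (injOn_snd_stabilizer_fixedSubset hZ _)

theorem exists_extension_graph_le_stabilizer
    (hZ : ∀ z : Z, Set.InjOn Prod.snd (stabilizer (P × P) z : Set (P × P)))
    (hP : IsPGroup p P) {φ : Q →* P}
    (h : ¬ p * Nat.card (Subgroup.centralizer (φ.range : Set P)) ∣
      Nat.card {z : Z // graph φ ≤ stabilizer (P × P) z}) :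
    ∃ ψ : DivisibleCategory.extender φ →* P,
      ψ.comp (Subgroup.inclusion (DivisibleCategory.le_extender φ)) = φ ∧
      ∃ z : Z, graph ψ ≤ stabilizer (P × P) z := by
  let A : Subgroup (P × P) := Subgroup.normalizer (graph φ : Set (P × P))
  let π : A →* P := (MonoidHom.snd P P).comp A.subtype
  obtain ⟨⟨z, hφ⟩, hz⟩ : ∃ z : fixedSubset (graph φ) Z, π.range ≤ (stabilizer A z).map π := by
    by_contra! hno
    have hnone : Nat.card {z : fixedSubset (graph φ) Z // π.range ≤ (stabilizer A z).map π} = 0 :=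
      Nat.card_eq_zero.2 (Or.inl ⟨fun z => hno z.1 z.2⟩)
    have hcount := card_modEq_card_range_le_map_stabilizer (π := π)
      ((isPGroup_prod hP hP).to_subgroup A) (injOn_snd_stabilizer_fixedSubset hZ (graph φ))
    rw [hnone, Nat.modEq_zero_iff_dvd,
      show Nat.card π.ker = _ from card_ker_snd_normalizer_graph φ] at hcount
    exact h hcount
  have hN : DivisibleCategory.extender φ ≤
      (stabilizer (P × P) z).map (MonoidHom.snd P P) := by
    intro u hu
    obtain ⟨a, ha, rfl⟩ := extender_le_map_snd_normalizer_graph hu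
    obtain ⟨b, hb, hba⟩ := hz ⟨⟨a, ha⟩, rfl⟩
    exact ⟨b, congrArg Subtype.val hb, hba⟩
  obtain ⟨ψ, hψ⟩ := exists_graph_le (hZ z) hN
  exact ⟨ψ, eq_of_graph_le (hZ z)
    (graph_le_iff.2 fun u => graph_le_iff.1 hψ (Subgroup.inclusion _ u)) hφ, z, hψ⟩

end FreeOnLeft

namespace DivisibleCategory

variable {P : Type*} [Group P] {F : DivisibleCategory P} {Q R : Subgroup P}

theorem mem_toP_of_conj {φ : Q →* P} (x : P) (h : ∀ u : Q, φ u = x * u * x⁻¹) :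
    φ ∈ F.toP Q := F.conj_mem x _ h

theorem subtype_mem_toP (Q : Subgroup P) : Q.subtype ∈ F.toP Q :=
  mem_toP_of_conj 1 fun u => by simp

theorem comp_mem_toP {θ : Q →* R} {σ : R →* P} (hθ : θ ∈ F.hom Q R) (hσ : σ ∈ F.toP R) :
    σ.comp θ ∈ F.toP Q := F.comp_mem (ψ := _) hθ hσ

theorem comp_inclusion_mem_toP (h : Q ≤ R) {σ : R →* P} (hσ : σ ∈ F.toP R) :
    σ.comp (Subgroup.inclusion h) ∈ F.toP Q :=
  comp_mem_toP (F.conj_mem 1 _ fun u => by simp) hσ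

theorem conj_comp_mem_toP {φ : Q →* P} (hφ : φ ∈ F.toP Q) (x : P) :
    (MulAut.conj x).toMonoidHom.comp φ ∈ F.toP Q :=
  F.comp_mem (ψ := (Subgroup.topEquiv : (⊤ : Subgroup P) ≃* P).symm.toMonoidHom.comp
    ((MulAut.conj x).toMonoidHom.comp (Subgroup.topEquiv : (⊤ : Subgroup P) ≃* P).toMonoidHom))
    hφ (F.conj_mem x _ fun _ => rfl)

theorem mem_hom_of_comp_mem_toP {ψ : R →* P} {θ : Q →* R} (hψ : ψ ∈ F.toP R)
    (h : ψ.comp θ ∈ F.toP Q) : θ ∈ F.hom Q R := F.full h hψ rfl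

theorem mem_hom_iff {φ : Q →* R} : φ ∈ F.hom Q R ↔ R.subtype.comp φ ∈ F.toP Q :=
  ⟨fun h => comp_mem_toP h (subtype_mem_toP R), mem_hom_of_comp_mem_toP (subtype_mem_toP R)⟩

theorem injective_of_mem_toP {φ : Q →* P} (hφ : φ ∈ F.toP Q) : Function.Injective φ :=
  fun _ _ h => F.injective hφ (Subtype.ext h)

theorem mem_toP_of_graph_le_stabilizer {σ : R →* P} (hσ : σ ∈ F.toP R)
    {x : (P × P) ⧸ graph σ} {φ : Q →* P} (h : graph φ ≤ stabilizer (P × P) x) : φ ∈ F.toP Q := by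
  induction x using QuotientGroup.induction_on with | _ y
  have hr (u : Q) : ∃ r : R, φ u = y.1 * σ r * y.1⁻¹ ∧ (r : P) = y.2⁻¹ * u * y.2⁻¹⁻¹ := by
    obtain ⟨r, hr⟩ := mem_stabilizer_mk_graph_iff.1 (graph_le_iff.1 h u)
    have hu : (u : P) = y.2 * r * y.2⁻¹ := congrArg Prod.snd hr
    exact ⟨r, congrArg Prod.fst hr, by rw [hu]; group⟩
  let θ : Q →* R := ((MulAut.conj y.2⁻¹).toMonoidHom.comp Q.subtype).codRestrict R fun u => by
    obtain ⟨⟨r, r_mem⟩, -, rfl⟩ := hr u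
    exact r_mem
  have hφ : φ = (MulAut.conj y.1).toMonoidHom.comp (σ.comp θ) := by
    ext u
    obtain ⟨r, hφu, hu⟩ := hr u
    obtain rfl : r = θ u := Subtype.ext hu
    exact hφu
  rw [hφ]
  exact conj_comp_mem_toP (comp_mem_toP (F.conj_mem y.2⁻¹ θ fun _ => rfl) hσ) y.1

section Hecke

variable [Finite P] {f : Burnside P P}

theorem hecke_toAddSubgroup_le {S : AddSubgroup (Burnside P P)}
    (h : ∀ (R : Subgroup P), ∀ σ ∈ F.toP R, indec σ ∈ S) : F.hecke.toAddSubgroup ≤ S := by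
  refine (AddSubgroup.closure_le S).2 ?_
  rintro _ ⟨R, σ, hσ, rfl⟩
  exact h R σ hσ

theorem dvd_of_mem_hecke (hf : f ∈ F.hecke) {d : ℤ} {L : Burnside P P →+ ℤ}
    (h : ∀ (R : Subgroup P), ∀ σ ∈ F.toP R, d ∣ L (indec σ)) : d ∣ L f :=
  Int.mem_zmultiples_iff.1 <| hecke_toAddSubgroup_le
    (S := (AddSubgroup.zmultiples d).comap L) (fun R σ hσ => Int.mem_zmultiples_iff.2 (h R σ hσ)) hf

theorem mem_toP_of_mark_ne_zero (hf : f ∈ F.hecke) {φ : Q →* P} (h : mark (graph φ) f ≠ 0) :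
    φ ∈ F.toP Q := by
  by_contra hφ
  refine h (zero_dvd_iff.1 (dvd_of_mem_hecke hf fun R σ hσ => ?_))
  have : IsEmpty {x : (P × P) ⧸ graph σ // graph φ ≤ stabilizer (P × P) x} :=
    ⟨fun x => hφ (mem_toP_of_graph_le_stabilizer hσ x.2)⟩
  rw [mark_indec, Nat.card_of_isEmpty, Nat.cast_zero]

variable {p : ℕ} [Fact p.Prime]

theorem sum_mark_graph_modEq (hP : IsPGroup p P) (hf : f ∈ F.hecke) (Q : Subgroup P)
    [Fintype (Q →* P)] :
    ∑ ψ : Q →* P, mark (graph ψ) f ≡ Nat.card P * length f [ZMOD (p * Nat.card P : ℕ)] := by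
  have h := dvd_of_mem_hecke hf (d := (p * Nat.card P : ℕ))
    (L := (Nat.card P : ℤ) • length - ∑ ψ : Q →* P, mark (graph ψ)) fun R σ _ => by
      have h := Int.natCast_modEq_iff.2
        (sum_card_graph_le_stabilizer_modEq (Z := (P × P) ⧸ graph σ) injOn_snd_stabilizer hP Q)
      simpa [mark_indec, card_mul_length_indec] using h.dvd
  exact Int.modEq_iff_dvd.2 (by simpa using h)

theorem card_centralizer_dvd_mark (hf : f ∈ F.hecke) (φ : Q →* P) :
    (Nat.card (Subgroup.centralizer (φ.range : Set P)) : ℤ) ∣ mark (graph φ) f :=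
  dvd_of_mem_hecke hf fun _ σ _ => by
    rw [mark_indec, Int.natCast_dvd_natCast]
    exact card_centralizer_dvd_card_graph_le_stabilizer injOn_snd_stabilizer φ

theorem exists_extension (hP : IsPGroup p P) (hf : f ∈ F.hecke) {φ : Q →* P}
    (h : ¬ ((p * Nat.card (Subgroup.centralizer (φ.range : Set P)) : ℕ) : ℤ) ∣
      mark (graph φ) f) :
    ∃ ψ ∈ F.toP (extender φ), ψ.comp (Subgroup.inclusion (le_extender φ)) = φ := by
  contrapose! h
  refine dvd_of_mem_hecke hf fun R σ hσ => ?_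
  rw [mark_indec, Int.natCast_dvd_natCast]
  by_contra hσφ
  obtain ⟨ψ, hψφ, x, hx⟩ := exists_extension_graph_le_stabilizer injOn_snd_stabilizer hP hσφ
  exact h ψ (mem_toP_of_graph_le_stabilizer hσ hx) hψφ

end Hecke

end DivisibleCategory

namespace DivisibleCategory

variable {P : Type*} [Group P] {F : DivisibleCategory P} {p : ℕ} {Q : Subgroup P}

theorem eq_of_hom_eq {F G : DivisibleCategory P} (h : F.hom = G.hom) : F = G := by
  cases F
  cases G
  congr

/-- The group `P` acts on `F(P, Q)` by composition with conjugations. -/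
instance conjAction (F : DivisibleCategory P) (Q : Subgroup P) : MulAction P (F.toP Q) where
  smul x φ := ⟨(MulAut.conj x).toMonoidHom.comp φ, conj_comp_mem_toP φ.2 x⟩
  one_smul φ := Subtype.ext (MonoidHom.ext fun u => by
    change 1 * (φ : Q →* P) u * 1⁻¹ = _
    simp)
  mul_smul x y φ := Subtype.ext (MonoidHom.ext fun u => by
    change x * y * (φ : Q →* P) u * (x * y)⁻¹ = x * (y * (φ : Q →* P) u * y⁻¹) * x⁻¹
    group)

theorem stabilizer_conjAction (φ : F.toP Q) :
    stabilizer P φ = Subgroup.centralizer ((φ : Q →* P).range : Set P) := by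
  ext x
  have hsmul : x • φ = φ ↔ ∀ u : Q, x * φ.1 u * x⁻¹ = φ.1 u :=
    Subtype.ext_iff.trans DFunLike.ext_iff
  simp only [mem_stabilizer_iff, hsmul, Subgroup.mem_centralizer_iff, SetLike.mem_coe,
    MonoidHom.mem_range, forall_exists_index, forall_apply_eq_imp_iff, mul_inv_eq_iff_eq_mul]
  exact forall_congr' fun u => eq_comm

theorem sup_centralizer_le_extender {T : Subgroup P} (ζ : T →* P) :
    T ⊔ Subgroup.centralizer (T : Set P) ≤ extender ζ := by
  refine sup_le (le_extender ζ) fun u hu =>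
    ⟨Subgroup.centralizer_le_normalizer _ hu, 1, one_mem _, fun x y h => ?_⟩
  have hux : u * x * u⁻¹ = x :=
    mul_inv_eq_iff_eq_mul.2 (Subgroup.mem_centralizer_iff.1 hu x x.2).symm
  obtain rfl : y = x := Subtype.ext (h.trans hux)
  simp

theorem FullyCentralized.card_centralizer_range {T R : Subgroup P} (hT : F.FullyCentralized T)
    (hR : T ⊔ Subgroup.centralizer (T : Set P) ≤ R) {ψ : R →* P} (hψ : ψ ∈ F.toP R) :
    Nat.card (Subgroup.centralizer
      ((ψ.comp (Subgroup.inclusion (le_sup_left.trans hR))).range : Set P)) =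
      Nat.card (Subgroup.centralizer (T : Set P)) := by
  have hrange : (ψ.comp (Subgroup.inclusion (le_sup_left.trans hR))).range =
      (T.subgroupOf (T ⊔ Subgroup.centralizer (T : Set P))).map
        (ψ.comp (Subgroup.inclusion hR)) := by
    rw [← Subgroup.inclusion_range le_sup_left, MonoidHom.map_range]
    rfl
  rw [hrange, ← hT _ (comp_inclusion_mem_toP hR hψ), Subgroup.card_map_of_injective,
    Nat.card_congr (Subgroup.subgroupOfEquivOfLe le_sup_right).toEquiv]
  exact (injective_of_mem_toP hψ).comp (Subgroup.inclusion_injective hR)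

theorem exists_mem_toP_range {φ ψ : Q →* P} (hφ : φ ∈ F.toP Q) (hψ : ψ ∈ F.toP Q) :
    ∃ ζ ∈ F.toP φ.range, ζ.range = ψ.range := by
  let e : Q ≃* φ.range := MonoidHom.ofInjective (injective_of_mem_toP hφ)
  have he : φ.comp e.symm.toMonoidHom = φ.range.subtype :=
    MonoidHom.ext fun u => congrArg Subtype.val (e.apply_symm_apply u)
  have hmem : e.symm.toMonoidHom ∈ F.hom φ.range Q :=
    mem_hom_of_comp_mem_toP hφ (he ▸ subtype_mem_toP φ.range)
  exact ⟨_, comp_mem_toP hmem hψ, by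
    rw [MonoidHom.range_comp, MonoidHom.range_eq_top.2 e.symm.surjective, ← MonoidHom.range_eq_map]⟩

theorem card_innerCategory_aut_top : Nat.card ((innerCategory P).aut ⊤) *
    Nat.card (Subgroup.centralizer ((⊤ : Subgroup P).subtype.range : Set P)) = Nat.card P := by
  let c : P →* MulAut (⊤ : Subgroup P) :=
    MulAut.conj.comp (Subgroup.topEquiv : (⊤ : Subgroup P) ≃* P).symm.toMonoidHom
  have hrange : (innerCategory P).aut ⊤ = c.range := by
    ext σ
    constructor
    · rintro ⟨x, hx⟩
      exact ⟨x, MulEquiv.ext fun u => Subtype.ext (hx u).symm⟩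
    · rintro ⟨x, rfl⟩
      exact ⟨x, fun u => rfl⟩
  have hker : Subgroup.centralizer ((⊤ : Subgroup P).subtype.range : Set P) = c.ker := by
    ext x
    rw [Subgroup.mem_centralizer_iff, MonoidHom.mem_ker]
    constructor
    · intro h
      refine MulEquiv.ext fun u => Subtype.ext ?_
      exact mul_inv_eq_iff_eq_mul.2 (h u ⟨u, rfl⟩).symm
    · rintro h _ ⟨u, rfl⟩
      have hconj : x * (u : P) * x⁻¹ = u := congrArg Subtype.val (DFunLike.congr_fun h u)
      exact (mul_inv_eq_iff_eq_mul.1 hconj).symm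
  rw [hrange, hker, ← Subgroup.index_ker, mul_comm, Subgroup.card_mul_index]

variable [Finite P]

theorem card_toP_top : Nat.card (F.toP ⊤) = Nat.card (F.aut ⊤) := by
  refine (Nat.card_congr (Equiv.ofBijective
    (fun σ => ⟨(Subgroup.subtype ⊤).comp (MulEquiv.toMonoidHom (σ : MulAut (⊤ : Subgroup P))),
      mem_hom_iff.1 σ.2⟩) ⟨?_, ?_⟩)).symm
  · intro σ τ h
    refine Subtype.ext (MulEquiv.ext fun u => Subtype.ext ?_)
    exact DFunLike.congr_fun (congrArg Subtype.val h) u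
  · rintro ⟨φ, hφ⟩
    let e : (⊤ : Subgroup P) →* (⊤ : Subgroup P) :=
      (Subgroup.topEquiv : (⊤ : Subgroup P) ≃* P).symm.toMonoidHom.comp φ
    have he : Function.Injective e := F.injective hφ
    exact ⟨⟨MulEquiv.ofBijective e (Finite.injective_iff_bijective.1 he), hφ⟩, rfl⟩

theorem exists_forall_card_centralizer_le (F : DivisibleCategory P) (Q : Subgroup P) :
    ∃ ζ ∈ F.toP Q, ∀ ψ ∈ F.toP Q, Nat.card (Subgroup.centralizer (ψ.range : Set P)) ≤
      Nat.card (Subgroup.centralizer (ζ.range : Set P)) := by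
  have : Nonempty (F.toP Q) := ⟨⟨_, subtype_mem_toP Q⟩⟩
  have : Finite (Q →* P) := DFunLike.finite _
  obtain ⟨ζ, hζ⟩ := Finite.exists_max fun ψ : F.toP Q =>
    Nat.card (Subgroup.centralizer ((ψ : Q →* P).range : Set P))
  exact ⟨ζ, ζ.2, fun ψ hψ => hζ ⟨ψ, hψ⟩⟩

/-- An element `f` of `H_F` whose length is prime to `p` and which satisfies the half of the
conditions defining `H^F` that concerns the products `res_φ · f`. -/
structure IsLeftCharacteristic (F : DivisibleCategory P) (p : ℕ) (f : Burnside P P) : Prop where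
  mem_hecke : f ∈ F.hecke
  comp_res : ∀ Q : Subgroup P, ∀ φ ∈ F.toP Q, comp (res φ) f = comp (res Q.subtype) f
  isCoprime_length : IsCoprime (length f) (p : ℤ)

theorem mark_graph_eq_mark_graph_subtype {f : Burnside P P} {φ : Q →* P}
    (h : comp (res φ) f = comp (res Q.subtype) f) :
    mark (graph φ) f = mark (graph Q.subtype) f := by
  rw [mark_graph_eq_mark_comp_res, h, ← mark_graph_eq_mark_comp_res]

namespace IsLeftCharacteristic

variable [Fact p.Prime] {f : Burnside P P}

theorem not_dvd_card_mul_mark (hf : F.IsLeftCharacteristic p f) (hP : IsPGroup p P)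
    (Q : Subgroup P) :
    ¬ ((p * Nat.card P : ℕ) : ℤ) ∣ Nat.card (F.toP Q) * mark (graph Q.subtype) f := by
  intro hdvd
  have : Finite (Q →* P) := DFunLike.finite _
  have := Fintype.ofFinite (Q →* P)
  classical
  have hsum : ∑ ψ : Q →* P, mark (graph ψ) f =
      Nat.card (F.toP Q) * mark (graph Q.subtype) f := by
    calc ∑ ψ : Q →* P, mark (graph ψ) f
        = ∑ ψ : Q →* P, if ψ ∈ F.toP Q then mark (graph Q.subtype) f else 0 := by
          refine Finset.sum_congr rfl fun ψ _ => ?_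
          split_ifs with hψ
          · exact mark_graph_eq_mark_graph_subtype (hf.comp_res Q ψ hψ)
          · exact not_not.1 fun h => hψ (mem_toP_of_mark_ne_zero hf.mem_hecke h)
      _ = Nat.card (F.toP Q) * mark (graph Q.subtype) f := by
          rw [← Finset.sum_filter, Finset.sum_const, nsmul_eq_mul, Nat.card_eq_fintype_card,
            ← Set.toFinset_card]
          congr 3
          ext
          simp
  have hlen := Int.modEq_iff_dvd.1 (sum_mark_graph_modEq hP hf.mem_hecke Q)
  rw [hsum, dvd_sub_left hdvd, mul_comm p, Nat.cast_mul] at hlen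
  have hp : (p : ℤ) ∣ length f :=
    Int.dvd_of_mul_dvd_mul_left (Nat.cast_ne_zero.2 Nat.card_pos.ne') hlen
  exact (Nat.prime_iff_prime_int.1 Fact.out).not_isUnit
    (hf.isCoprime_length.isUnit_of_dvd' hp dvd_rfl)

theorem mem_toP_iff (hf : F.IsLeftCharacteristic p f) (hP : IsPGroup p P) {φ : Q →* P} :
    φ ∈ F.toP Q ↔ comp (res φ) f = comp (res Q.subtype) f := by
  refine ⟨hf.comp_res Q φ, fun h => mem_toP_of_mark_ne_zero hf.mem_hecke ?_⟩
  rw [mark_graph_eq_mark_graph_subtype h]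
  intro hzero
  exact hf.not_dvd_card_mul_mark hP Q (by simp [hzero])

theorem minimalHecke_eq (hf : F.IsLeftCharacteristic p f) (hP : IsPGroup p P) :
    minimalHecke f = F.hecke := by
  refine le_antisymm (sInf_le ⟨⟨F, rfl⟩, hf.mem_hecke⟩) (le_sInf ?_)
  rintro _ ⟨⟨F', rfl⟩, hf'⟩
  refine hecke_toAddSubgroup_le (S := F'.hecke.toAddSubgroup) fun R σ hσ =>
    AddSubgroup.subset_closure ⟨R, σ, mem_toP_of_mark_ne_zero hf' ?_, rfl⟩
  rw [mark_graph_eq_mark_graph_subtype (hf.comp_res R σ hσ)]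
  intro hzero
  exact hf.not_dvd_card_mul_mark hP R (by simp [hzero])

theorem not_dvd_mark_of_forall_le (hf : F.IsLeftCharacteristic p f) (hP : IsPGroup p P)
    {ζ : Q →* P} (hζ : ∀ ψ ∈ F.toP Q, Nat.card (Subgroup.centralizer (ψ.range : Set P)) ≤
      Nat.card (Subgroup.centralizer (ζ.range : Set P))) :
    ¬ ((p * Nat.card (Subgroup.centralizer (ζ.range : Set P)) : ℕ) : ℤ) ∣
      mark (graph Q.subtype) f := by
  intro hdvd
  have hindex : (Subgroup.centralizer (ζ.range : Set P)).index ∣ Nat.card (F.toP Q) := by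
    have : Finite (Q →* P) := DFunLike.finite _
    refine dvd_card_of_dvd_index (A := P) _ fun ψ => ?_
    rw [stabilizer_conjAction]
    exact index_dvd_index_of_card_le hP (hζ ψ ψ.2)
  refine hf.not_dvd_card_mul_mark hP Q ?_
  rw [← (Subgroup.centralizer (ζ.range : Set P)).index_mul_card, mul_left_comm, Nat.cast_mul]
  exact mul_dvd_mul (Int.natCast_dvd_natCast.2 hindex) hdvd

theorem card_centralizer_le_of_fullyCentralized (hf : F.IsLeftCharacteristic p f)
    (hP : IsPGroup p P) {T : Subgroup P} (hT : F.FullyCentralized T) {ψ : T →* P}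
    (hψ : ψ ∈ F.toP T) : Nat.card (Subgroup.centralizer (ψ.range : Set P)) ≤
      Nat.card (Subgroup.centralizer (T : Set P)) := by
  obtain ⟨ζ, hζ, hmax⟩ := exists_forall_card_centralizer_le F T
  have hmark := hf.not_dvd_mark_of_forall_le hP hmax
  rw [← mark_graph_eq_mark_graph_subtype (hf.comp_res T ζ hζ)] at hmark
  obtain ⟨η, hη, hext⟩ := exists_extension hP hf.mem_hecke hmark
  rw [← hT.card_centralizer_range (sup_centralizer_le_extender ζ) hη, hext]
  exact hmax ψ hψ

theorem exists_extension_of_fullyCentralized (hf : F.IsLeftCharacteristic p f)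
    (hP : IsPGroup p P) {φ : Q →* P} (hφ : φ ∈ F.toP Q) (hT : F.FullyCentralized φ.range) :
    ∃ ψ ∈ F.toP (extender φ), ψ.comp (Subgroup.inclusion (le_extender φ)) = φ := by
  refine exists_extension hP hf.mem_hecke ?_
  rw [mark_graph_eq_mark_graph_subtype (hf.comp_res Q φ hφ)]
  refine hf.not_dvd_mark_of_forall_le hP fun ψ hψ => ?_
  obtain ⟨ζ, hζ, hrange⟩ := exists_mem_toP_range hφ hψ
  rw [← hrange]
  exact hf.card_centralizer_le_of_fullyCentralized hP hT hζ

theorem exists_sylow_eq_innerCategory_aut (hf : F.IsLeftCharacteristic p f)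
    (hP : IsPGroup p P) : ∃ S : Sylow p (F.aut ⊤),
      (S : Subgroup (F.aut ⊤)) = ((innerCategory P).aut ⊤).subgroupOf (F.aut ⊤) := by
  have hle : (innerCategory P).aut ⊤ ≤ F.aut ⊤ := by
    rintro σ ⟨x, hx⟩
    exact F.conj_mem x _ hx
  set I := ((innerCategory P).aut ⊤).subgroupOf (F.aut ⊤)
  have hmul : Nat.card I * Nat.card
      (Subgroup.centralizer ((⊤ : Subgroup P).subtype.range : Set P)) = Nat.card P := by
    rw [Nat.card_congr (Subgroup.subgroupOfEquivOfLe hle).toEquiv, card_innerCategory_aut_top]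
  have hI : IsPGroup p I := by
    obtain ⟨n, hn⟩ := hP.exists_card_eq
    obtain ⟨m, -, hm⟩ := (Nat.dvd_prime_pow Fact.out).1 (hn ▸ Dvd.intro _ hmul)
    exact IsPGroup.of_card hm
  refine ⟨hI.toSylow fun hindex => hf.not_dvd_card_mul_mark hP ⊤ ?_, rfl⟩
  have hcentralizer := card_centralizer_dvd_mark hf.mem_hecke (⊤ : Subgroup P).subtype
  rw [card_toP_top, ← hmul, ← I.card_mul_index, mul_left_comm, ← mul_assoc, Nat.cast_mul]
  exact mul_dvd_mul (Int.natCast_dvd_natCast.2 (mul_dvd_mul_left _ hindex)) hcentralizer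

theorem isFrobenius (hf : F.IsLeftCharacteristic p f) (hP : IsPGroup p P) : F.IsFrobenius p :=
  ⟨hf.exists_sylow_eq_innerCategory_aut hP, fun _ _ hφ hT =>
    hf.exists_extension_of_fullyCentralized hP hφ hT⟩

end IsLeftCharacteristic

theorem stabilizerCategory_eq {f : Burnside P P} (hf : f ∈ F.invariants)
    (h : ∀ (Q : Subgroup P) (φ : Q →* P),
      comp (res φ) f = comp (res Q.subtype) f → φ ∈ F.toP Q) :
    stabilizerCategory f = F := by
  refine eq_of_hom_eq (funext₂ fun Q R => Set.ext fun φ => ?_)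
  exact ⟨fun hφ => mem_hom_iff.2 (h Q _ hφ.2.1),
    fun hφ => ⟨F.injective hφ, hf Q _ (mem_hom_iff.1 hφ)⟩⟩

end DivisibleCategory

end Puig

theorem proposition7p6_general {p : ℕ} [Fact p.Prime] {P : Type*} [Group P] [Finite P]
    (hP : IsPGroup p P) (F : Puig.DivisibleCategory P) (f : Puig.Burnside P P)
    (hf : f ∈ F.hecke) (hlen : IsCoprime (Puig.length f) (p : ℤ))
    (hres : ∀ (Q : Subgroup P), ∀ φ ∈ F.toP Q,
      Puig.comp (Puig.res φ) f = Puig.comp (Puig.res Q.subtype) f) :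
    F.IsFrobenius p ∧
      (∀ (Q : Subgroup P) (φ : Q →* P), φ ∈ F.toP Q ↔
        Puig.comp (Puig.res φ) f = Puig.comp (Puig.res Q.subtype) f) ∧
      Puig.minimalHecke f = F.hecke :=
  have h : F.IsLeftCharacteristic p f := ⟨hf, hres, hlen⟩
  ⟨h.isFrobenius hP, fun _ _ => h.mem_toP_iff hP, h.minimalHecke_eq hP⟩

theorem proposition7p6 {p : ℕ} [Fact p.Prime] {P : Type*} [Group P] [Finite P]
    (hP : IsPGroup p P) (F : Puig.DivisibleCategory P) (f : Puig.Burnside P P)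
    (hf : f ∈ F.heckeInvariants) (hlen : IsCoprime (Puig.length f) (p : ℤ)) :
    F.IsFrobenius p ∧ Puig.stabilizerCategory f = F ∧ Puig.minimalHecke f = F.hecke :=
  have ⟨hF, hmem, hH⟩ :=
    proposition7p6_general hP F f hf.1 hlen fun Q φ hφ => (hf.2 Q φ hφ).1
  ⟨hF, Puig.DivisibleCategory.stabilizerCategory_eq hf.2 fun Q φ => (hmem Q φ).2, hH⟩
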